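/- **Theorem 1.3.** Let $\mathcal L$ be a first-order language with equality. A *dynamical (coherent) theory* $\mathcal D$ in $\mathcal L$ is a set of axioms of the form $$H(\mathbf x)\ \vdash\ \exists \mathbf y_1\, A_1(\mathbf x,\mathbf y_1)\ \vee\ \cdots\ \vee\ \exists \mathbf y_k\, A_k(\mathbf x,\mathbf y_k)\qquad(k\ge 0),$$ where $H$ and the $A_i$ are finite conjunctions of atomic formulas (for $k=0$ the right-hand side is $\bot$). An axiom $H(\mathbf x)\vdash K(\mathbf x)$ with $K$ atomic is called *algebraic*. Every dynamical theory is understood to contain the algebraic axioms expressing that $=$ is an equivalence relation compatible with the function and relation symbols. A *presentation* $(G;R)$ consists of a set $G$ of variables (generators) and a set $R$ of atomic formulas in these variables, both possibly infinite; a *fact* of $(G;R)$ is an atomic formula $B(\mathbf t)$ with variables in $G$. A *covering* of $(G;R)$ in $\mathcal D$ is a finite tree with a presentation $(G_n;R_n)$ at each node $n$, built as follows. At the root, $G_n=G$, and $R_n$ consists of $R$ and finitely many consequences of $R$ under the algebraic axioms of $\mathcal D$. If $\mathbf t$ is a list of terms in the variables $G_n$, if the displayed expression is an axiom of $\mathcal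 D$, and if all the conjuncts of $H(\mathbf t)$ are in $R_n$, then the node $n$ may be given $k$ children, the $i$-th of which has the generators $G_n\cup\{\mathbf z_i\}$, with $\mathbf z_i$ new, and the relations $R_n\cup\{A_i(\mathbf t,\mathbf z_i)\}$ together with finitely many consequences of these under the algebraic axioms of $\mathcal D$. A node to which an axiom with $k=0$ has been applied is dead; the other terminal nodes are the leaves. A *dynamical proof* of $R\vdash B(\mathbf t)$ in $\mathcal D$ is a covering of $(G;R)$ such that $B(\mathbf t)$ is one of the relations at every leaf. A *classical proof* of $R\vdash B(\mathbf t)$ in $\mathcal D$ is a derivation, in natural deduction for classical first-order logic with equality, of $B(\mathbf t)$ from finitely many formulas of $R$ and finitely many sentences $\forall\mathbf x\,\bigl(H\to\bigvee_i\exists\mathbf y_i\,A_i\bigr)$ expressing axioms of $\mathcal D$; besides the generators, it may use countably many further variables. Let $\mathcal L$ be a language and $G$ a set of generators such that there is at least one term in the variables $G$ (this is automatic if $G\neq\emptyset$, if $\mathcal L$ has a constant, or if the predicate of $B$ has at least one argument). Then: 1. For every dynamical theory $\mathcal D$, every presentation $(G;R)$ and every fact $B(\mathbf t)$ of it, if there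 is a classical proof of $R\vdash B(\mathbf t)$ in $\mathcal D$, then there is a dynamical proof of $R\vdash B(\mathbf t)$ in $\mathcal D$. 2. The passage is constructive. Suppose that the symbols of $\mathcal L$ and the elements of $G$ are effectively numbered, with the arities of the symbols computable, and number classical and dynamical proofs accordingly, as finite labelled trees. Then there is a partial recursive function $F$, not depending on $\mathcal D$, $R$ or $B(\mathbf t)$, that is defined at the number of every classical proof of $R\vdash B(\mathbf t)$ in $\mathcal D$, for all $\mathcal D$, $R$ and $B(\mathbf t)$, and whose value there is the number of a dynamical proof of $R\vdash B(\mathbf t)$ in $\mathcal D$. -/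

import Mathlib

universe u v w w'

namespace Dynamical

/-! ## Atomic formulas, presentations, dynamical axioms -/

/-- Atomic formulas of the language `L` (which has equality) in the variables `α`. -/
inductive Atom (L : FirstOrder.Language.{u, v}) (α : Type w) : Type (max u v w)
  | equal (s t : L.Term α) : Atom L α
  | rel {n : ℕ} (r : L.Relations n) (ts : Fin n → L.Term α) : Atom L α

namespace Atom

variable {L : FirstOrder.Language.{u, v}} {α : Type w} {β : Type w'}

/-- Simultaneous substitution of terms for the variables of an atomic formula. -/
def subst (σ : α → L.Term β) : Atom L α → Atom L β
  | equal s t => equal (s.subst σ) (t.subst σ)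
  | rel r ts => rel r fun i => (ts i).subst σ

/-- Renaming of the variables of an atomic formula. -/
def relabel (g : α → β) : Atom L α → Atom L β
  | equal s t => equal (s.relabel g) (t.relabel g)
  | rel r ts => rel r fun i => (ts i).relabel g

/-- An atomic formula as a first order formula, its variables being read through `g` as free
variables (in `β`) or as de Bruijn variables (in `Fin k`). -/
def toBounded {k : ℕ} (g : α → β ⊕ Fin k) : Atom L α → L.BoundedFormula β k
  | equal s t => (s.relabel g).bdEqual (t.relabel g)
  | rel r ts => r.boundedFormula fun i => (ts i).relabel g

end Atom

/-- An existentially quantified conjunction `∃ y₁ … y_arity, ⋀ atoms`, in the variables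
`x₁, …, xₙ` (`Sum.inl`) and `y₁, …, y_arity` (`Sum.inr`). -/
structure Disjunct (L : FirstOrder.Language.{u, v}) (n : ℕ) : Type (max u v) where
  arity : ℕ
  atoms : List (Atom L (Fin n ⊕ Fin arity))

/-- A dynamical (coherent) axiom `H(x) ⊢ ∃ y₁ A₁(x, y₁) ∨ ⋯ ∨ ∃ yₖ Aₖ(x, yₖ)`, where `x` is a list
of `n` variables, `H` is the conjunction of the list `hyp` and the disjuncts are those of the list
`concl`. The empty list `concl` is `⊥`. -/
structure DynAxiom (L : FirstOrder.Language.{u, v}) : Type (max u v) where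
  n : ℕ
  hyp : List (Atom L (Fin n))
  concl : List (Disjunct L n)

/-- The algebraic axiom `H(x) ⊢ K(x)`, with `K` a single atomic formula. -/
abbrev DynAxiom.algebraic {L : FirstOrder.Language.{u, v}} {n : ℕ} (H : List (Atom L (Fin n)))
    (K : Atom L (Fin n)) : DynAxiom L :=
  ⟨n, H, [⟨0, [K.relabel Sum.inl]⟩]⟩

/-- A dynamical theory is a (possibly infinite) set of dynamical axioms. -/
abbrev DynTheory (L : FirstOrder.Language.{u, v}) : Type (max u v) := Set (DynAxiom L)

/-- The axioms for the substitution of equal terms; they are all algebraic. -/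
inductive IsEqAxiom (L : FirstOrder.Language.{u, v}) : DynAxiom L → Prop
  | refl : IsEqAxiom L (.algebraic (n := 1) [] (.equal (.var 0) (.var 0)))
  | symm : IsEqAxiom L (.algebraic (n := 2) [.equal (.var 0) (.var 1)] (.equal (.var 1) (.var 0)))
  | trans : IsEqAxiom L (.algebraic (n := 3)
      [.equal (.var 0) (.var 1), .equal (.var 1) (.var 2)] (.equal (.var 0) (.var 2)))
  | func {n : ℕ} (f : L.Functions n) : IsEqAxiom L (.algebraic (n := n + n)
      (List.ofFn fun i : Fin n => .equal (.var (Fin.castAdd n i)) (.var (Fin.natAdd n i)))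
      (.equal (.func f fun i => .var (Fin.castAdd n i)) (.func f fun i => .var (Fin.natAdd n i))))
  | rel {n : ℕ} (r : L.Relations n) : IsEqAxiom L (.algebraic (n := n + n)
      (.rel r (fun i => .var (Fin.castAdd n i)) ::
        List.ofFn fun i : Fin n => .equal (.var (Fin.castAdd n i)) (.var (Fin.natAdd n i)))
      (.rel r fun i => .var (Fin.natAdd n i)))

/-- Every dynamical theory is understood to allow the substitution of equal terms. -/
def DynTheory.withEq {L : FirstOrder.Language.{u, v}} (D : DynTheory L) : DynTheory L :=
  D ∪ {a | IsEqAxiom L a}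

/-! ## Coverings and dynamical proofs -/

section Coverings

variable {L : FirstOrder.Language.{u, v}} {α : Type w}

/-- Let a node have the generators `α ⊕ Fin m` and the relations `S`, and let `d` be a disjunct
of an axiom, with the terms `σ` substituted for `x`. These are the relations of the
corresponding child: those of `S`, and `A(σ, z)`, where `z` is the list of the `d.arity` new
generators. -/
def extend {m n : ℕ} (S : Set (Atom L (α ⊕ Fin m))) (σ : Fin n → L.Term (α ⊕ Fin m))
    (d : Disjunct L n) : Set (Atom L (α ⊕ Fin (m + d.arity))) :=
  Atom.relabel (Sum.map id (Fin.castAdd d.arity)) '' S ∪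
    {A | A ∈ d.atoms.map (Atom.subst (Sum.elim
      (fun j => (σ j).relabel (Sum.map id (Fin.castAdd d.arity)))
      (fun z => .var (Sum.inr (Fin.natAdd m z)))))}

/-- `Covering D m S` is the type of coverings, in the theory `D`, of the presentation with the
generators `α ⊕ Fin m` (the original generators and `m` new ones) and the relations `S`:
* `leaf`: a terminal node;
* `alg`: a consequence of the present relations under an algebraic axiom `H ⊢ K` of the theory is
  added to the relations of the node;
* `branch`: a dynamical axiom is applied and creates one child per disjunct of its conclusion;
  if there is none, then the node is dead. -/
inductive Covering (D : DynTheory L) : (m : ℕ) → Set (Atom L (α ⊕ Fin m)) → Type (max u v w)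
  | leaf {m : ℕ} {S : Set (Atom L (α ⊕ Fin m))} : Covering D m S
  | alg {m : ℕ} {S : Set (Atom L (α ⊕ Fin m))} {n : ℕ} (H : List (Atom L (Fin n)))
      (K : Atom L (Fin n)) (mem : DynAxiom.algebraic H K ∈ D.withEq)
      (σ : Fin n → L.Term (α ⊕ Fin m)) (hyp : ∀ A ∈ H, A.subst σ ∈ S)
      (next : Covering D m (insert (K.subst σ) S)) : Covering D m S
  | branch {m : ℕ} {S : Set (Atom L (α ⊕ Fin m))} (a : DynAxiom L) (mem : a ∈ D.withEq)
      (σ : Fin a.n → L.Term (α ⊕ Fin m)) (hyp : ∀ A ∈ a.hyp, A.subst σ ∈ S)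
      (children : ∀ i : Fin a.concl.length,
        Covering D (m + (a.concl.get i).arity) (extend S σ (a.concl.get i))) : Covering D m S

/-- The fact `B` is one of the relations at every leaf of the covering. -/
def Covering.Proves {D : DynTheory L} (B : Atom L α) :
    {m : ℕ} → {S : Set (Atom L (α ⊕ Fin m))} → Covering D m S → Prop
  | _, S, leaf => B.relabel Sum.inl ∈ S
  | _, _, alg _ _ _ _ _ next => next.Proves B
  | _, _, branch _ _ _ _ children => ∀ i, (children i).Proves B

/-- A dynamical proof in `D` of the fact `B` in the presentation `(α; R)`. -/
structure DynProof (D : DynTheory L) (R : Set (Atom L α)) (B : Atom L α) :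
    Type (max u v w) where
  covering : Covering D 0 (Atom.relabel (Sum.inl : α → α ⊕ Fin 0) '' R)
  proves : covering.Proves B

end Coverings

/-! ## Classical first order proofs -/

section Classical

variable {L : FirstOrder.Language.{u, v}}

/-- Existential quantification of the last `m` de Bruijn variables. -/
def exsLast {V : Type w} {n : ℕ} : (m : ℕ) → L.BoundedFormula V (n + m) → L.BoundedFormula V n
  | 0, φ => φ
  | m + 1, φ => exsLast m (FirstOrder.Language.BoundedFormula.ex φ)

/-- The formula `∃ y, ⋀ atoms`, with the de Bruijn variables `x₁, …, xₙ`. -/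
def Disjunct.toBounded {V : Type w} {n : ℕ} (d : Disjunct L n) : L.BoundedFormula V n :=
  exsLast d.arity
    ((d.atoms.map (Atom.toBounded fun x => Sum.inr (finSumFinEquiv x))).foldr (· ⊓ ·) ⊤)

/-- The first order sentence `∀ x, (⋀ H → ⋁ᵢ ∃ yᵢ, ⋀ Aᵢ)` expressing a dynamical axiom. -/
def DynAxiom.toFormula {V : Type w} (a : DynAxiom L) : L.Formula V :=
  FirstOrder.Language.BoundedFormula.alls
    (((a.hyp.map (Atom.toBounded Sum.inr)).foldr (· ⊓ ·) ⊤).imp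
      ((a.concl.map Disjunct.toBounded).foldr (· ⊔ ·) ⊥))

/-- The instance `φ(t)` of a formula `φ` with one de Bruijn variable. -/
def inst {V : Type w} (φ : L.BoundedFormula V 1) (t : L.Term V) : L.Formula V :=
  φ.toFormula.subst (Sum.elim FirstOrder.Language.Term.var fun _ => t)

open Classical in
/-- The variable `x` does not occur free in `φ`. -/
def Fresh {V : Type w} {n : ℕ} (x : V) (φ : L.BoundedFormula V n) : Prop :=
  x ∉ φ.freeVarFinset

/-- Natural deduction for classical first order logic with equality. The primitive connectives are
`⊥`, `→` and `∀`, as in `FirstOrder.Language.BoundedFormula`; the other ones are defined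
classically. `Derivation Γ φ` is the type of derivations of `φ` from the finite list `Γ` of
assumptions. -/
inductive Derivation {V : Type w} : List (L.Formula V) → L.Formula V → Type (max u v w)
  | ax {Γ : List (L.Formula V)} {φ : L.Formula V} (h : φ ∈ Γ) : Derivation Γ φ
  | impIntro {Γ : List (L.Formula V)} {φ ψ : L.Formula V} (d : Derivation (φ :: Γ) ψ) :
      Derivation Γ (φ.imp ψ)
  | impElim {Γ : List (L.Formula V)} {φ ψ : L.Formula V} (d : Derivation Γ (φ.imp ψ))
      (e : Derivation Γ φ) : Derivation Γ ψ
  /-- Proof by contradiction. -/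
  | raa {Γ : List (L.Formula V)} {φ : L.Formula V} (d : Derivation (φ.not :: Γ) ⊥) :
      Derivation Γ φ
  | allIntro {Γ : List (L.Formula V)} {φ : L.BoundedFormula V 1} (x : V)
      (hφ : Fresh x φ) (hΓ : ∀ ψ ∈ Γ, Fresh x ψ) (d : Derivation Γ (inst φ (.var x))) :
      Derivation Γ φ.all
  | allElim {Γ : List (L.Formula V)} (φ : L.BoundedFormula V 1) (t : L.Term V)
      (d : Derivation Γ φ.all) : Derivation Γ (inst φ t)
  | eqRefl {Γ : List (L.Formula V)} (t : L.Term V) : Derivation Γ (t.equal t)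
  | eqSubst {Γ : List (L.Formula V)} (φ : L.BoundedFormula V 1) (s t : L.Term V)
      (d : Derivation Γ (s.equal t)) (e : Derivation Γ (inst φ s)) : Derivation Γ (inst φ t)

/-- An atomic formula in the generators `α`, as a formula in the generators and an infinite stock
`ℕ` of further variables. -/
def Atom.toFormula {α : Type w} (A : Atom L α) : L.Formula (α ⊕ ℕ) :=
  A.toBounded fun x => Sum.inl (Sum.inl x)

/-- A proof of `R ⊢ B` in the classical first order theory `D`: a derivation of `B` from finitely
many axioms of `D` and finitely many relations of `R`. Besides the generators, it may use the
variables in `ℕ`. -/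
structure ClassicalProof {α : Type w} (D : DynTheory L) (R : Set (Atom L α)) (B : Atom L α) :
    Type (max u v w) where
  axs : List (DynAxiom L)
  axs_mem : ∀ a ∈ axs, a ∈ D
  rels : List (Atom L α)
  rels_mem : ∀ A ∈ rels, A ∈ R
  deriv : Derivation (axs.map DynAxiom.toFormula ++ rels.map Atom.toFormula) B.toFormula

end Classical

/-! ## Gödel numbers of classical and of dynamical proofs

The symbols of the language and the generators are numbered by `Encodable` instances; terms and
formulas are then numbered as in Mathlib, and proofs are numbered as finite labelled trees. -/

section Codes

variable {L : FirstOrder.Language.{u, v}} [Encodable (Σ n, L.Functions n)] [Encodable (Σ n, L.Relations n)]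
  {α : Type w} [Encodable α]

/-- Gödel number of an atomic formula. -/
def Atom.code : Atom L α → ℕ
  | equal s t => Encodable.encode (0, Encodable.encode s, Encodable.encode t)
  | @rel _ _ n r ts => Encodable.encode (1, Encodable.encode (⟨n, r⟩ : Σ n, L.Relations n),
      List.ofFn fun i => Encodable.encode (ts i))

/-- Gödel number of a dynamical axiom. -/
def DynAxiom.code (a : DynAxiom L) : ℕ :=
  Encodable.encode (a.n, a.hyp.map Atom.code, a.concl.map fun d => (d.arity, d.atoms.map Atom.code))

/-- Gödel number of a covering: the tree of the axioms applied and of the terms substituted in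
them. -/
def Covering.code {D : DynTheory L} :
    {m : ℕ} → {S : Set (Atom L (α ⊕ Fin m))} → Covering D m S → ℕ
  | _, _, leaf => Encodable.encode (0, 0)
  | _, _, alg H K _ σ _ next => Encodable.encode
      (1, (DynAxiom.algebraic H K).code, (List.ofFn fun j => Encodable.encode (σ j)), next.code)
  | _, _, branch a _ σ _ children => Encodable.encode
      (2, a.code, (List.ofFn fun j => Encodable.encode (σ j)),
        List.ofFn fun i => (children i).code)

/-- Gödel number of a dynamical proof. -/
def DynProof.code {D : DynTheory L} {R : Set (Atom L α)} {B : Atom L α} (τ : DynProof D R B) : ℕ :=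
  τ.covering.code

/-- Gödel number of a first order formula. -/
def formulaCode {n : ℕ} (φ : L.BoundedFormula α n) : ℕ :=
  Encodable.encode φ.listEncode

/-- Gödel number of a derivation: the tree of its inferences, with the assumptions and the
conclusion of each of them, the formulas, terms and variables that it instantiates, and the
Gödel numbers of its premises. -/
def Derivation.code : {Γ : List (L.Formula α)} → {φ : L.Formula α} → Derivation Γ φ → ℕ
  | _, _, @ax _ _ Γ φ _ => Encodable.encode (0, Γ.map formulaCode, formulaCode φ, ([] : List ℕ))
  | _, _, @impIntro _ _ Γ φ ψ d =>
      Encodable.encode (1, Γ.map formulaCode, formulaCode (φ.imp ψ), [d.code])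
  | _, _, @impElim _ _ Γ _ ψ d e =>
      Encodable.encode (2, Γ.map formulaCode, formulaCode ψ, [d.code, e.code])
  | _, _, @raa _ _ Γ φ d => Encodable.encode (3, Γ.map formulaCode, formulaCode φ, [d.code])
  | _, _, @allIntro _ _ Γ φ x _ _ d => Encodable.encode
      (4, Γ.map formulaCode, formulaCode φ.all, [Encodable.encode x, d.code])
  | _, _, @allElim _ _ Γ φ t d => Encodable.encode
      (5, Γ.map formulaCode, formulaCode (inst φ t),
        [formulaCode φ, Encodable.encode t, d.code])
  | _, _, @eqRefl _ _ Γ t =>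
      Encodable.encode (6, Γ.map formulaCode, formulaCode (t.equal t), ([] : List ℕ))
  | _, _, @eqSubst _ _ Γ φ s t d e => Encodable.encode
      (7, Γ.map formulaCode, formulaCode (inst φ t),
        [formulaCode φ, Encodable.encode s, Encodable.encode t, d.code, e.code])

/-- Gödel number of a classical proof: the axioms and the relations used, the fact proved, and the
derivation. -/
def ClassicalProof.code {D : DynTheory L} {R : Set (Atom L α)} {B : Atom L α}
    (π : ClassicalProof D R B) : ℕ :=
  Encodable.encode (π.axs.map DynAxiom.code, π.rels.map Atom.code, B.code, π.deriv.code)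

end Codes

end Dynamical

/-! The first part is a Kripke-style forcing argument combined with Friedman's trick of reading `⊥`
as the fact to be proved. A node is a number of new generators together with a set of relations, and
it is `Provable` when a covering below it has `B` at every leaf. Its extensions are all nodes with
at least as many generators and relations. The double negation `DNeg X`, taken with `Provable` in
the place of `⊥`, is a closure operator on predicates of nodes. Forcing puts it on `⊥` and on atomic
formulas, quantifies over the terms available at the node, and treats `→` and `∀` as Kripke models
do. Every forced predicate is then equal to its double negation (`Forces.stable`), so proof by
contradiction is sound and all of classical natural deduction is (`Derivation.forces`). A dynamical
axiom is forced because it may be applied in a covering: a goal equal to its double negation may be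
proved by branching and treating each child (`Stable.of_rule`, `DynAxiom.forces`). The equality
rules follow from the equality axioms of the theory (`EqAt.forces`). Hence a classical proof makes
the root force `B`. As `B` is trivially provable wherever it is a relation, the double negation
unwinds to a covering of the root.

The second part is an unbounded search. The number of a classical proof contains the axioms, the
relations and the goal, which is all that is needed to recognize a dynamical proof. A candidate is a
list of instructions that builds a covering from the leaves upwards, and a primitive recursive
checker runs it, given finite tables of arities. All that the checker accepts is the number of a
dynamical proof (`judgmentTrue_of_mem_run`). By the first part some candidate is accepted
(`Provable.exists_instructions`), so the search ends. -/

namespace Dynamical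

open FirstOrder FirstOrder.Language

/-! ### Substitution in terms and atomic formulas -/

section Terms

variable {L : FirstOrder.Language.{u, v}} {α : Type w} {β : Type w'}

/-- The structure of terms, in which the function symbols act by forming terms. -/
@[reducible] def termStructure (L : FirstOrder.Language.{u, v}) (α : Type w) :
    L.Structure (L.Term α) where
  funMap := Term.func
  RelMap _ _ := False

attribute [local instance] termStructure

/-- In the structure of terms evaluation is substitution, so the laws of `Term.realize` serve for
assignments of terms to variables. -/
theorem term_subst_eq_realize (t : L.Term α) (σ : α → L.Term β) : t.subst σ = t.realize σ := by
  induction t with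
  | var => rfl
  | func f ts ih => simp only [Term.subst, Term.realize, ih]; rfl

theorem relabel_eq_subst (t : L.Term α) (g : α → β) :
    t.relabel g = t.subst fun x => .var (g x) := by
  induction t with
  | var => rfl
  | func f ts ih => simp only [Term.subst, Term.relabel, ih]

theorem term_subst_subst {γ : Type*} (t : L.Term α) (σ : α → L.Term β) (τ : β → L.Term γ) :
    (t.subst σ).subst τ = t.subst fun x => (σ x).subst τ := by
  induction t with
  | var => rfl
  | func f ts ih => simp only [Term.subst, ih]

theorem relabel_injective {g : α → β} (hg : Function.Injective g) :
    Function.Injective (Term.relabel g : L.Term α → L.Term β) := by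
  intro s
  induction s with
  | var x =>
    intro t h
    cases t with
    | var y => simp only [Term.relabel, Term.var.injEq] at h; rw [hg h]
    | func f ts => simp [Term.relabel] at h
  | func f ts ih =>
    intro t h
    cases t with
    | var y => simp [Term.relabel] at h
    | func f' ts' =>
      simp only [Term.relabel, Term.func.injEq] at h
      obtain ⟨rfl, h1, h2⟩ := h
      obtain rfl := eq_of_heq h1
      congr 1
      funext i
      exact ih i (congrFun (eq_of_heq h2) i)

namespace Atom

theorem relabel_eq_subst (A : Atom L α) (g : α → β) :
    A.relabel g = A.subst fun x => .var (g x) := by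
  cases A <;> simp only [relabel, subst, Dynamical.relabel_eq_subst]

theorem subst_subst {γ : Type*} (A : Atom L α) (σ : α → L.Term β) (τ : β → L.Term γ) :
    (A.subst σ).subst τ = A.subst fun x => (σ x).subst τ := by
  cases A <;> simp only [subst, term_subst_subst]

theorem relabel_injective {g : α → β} (hg : Function.Injective g) :
    Function.Injective (Atom.relabel g : Atom L α → Atom L β) := by
  intro A A' h
  cases A <;> cases A' <;> simp only [relabel, equal.injEq, rel.injEq, reduceCtorEq] at h
  · rw [Dynamical.relabel_injective hg h.1, Dynamical.relabel_injective hg h.2]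
  · obtain ⟨rfl, h1, h2⟩ := h
    obtain rfl := eq_of_heq h1
    congr 1
    funext i
    exact Dynamical.relabel_injective hg (congrFun (eq_of_heq h2) i)

end Atom

/-- The term `t` mentions only the first `m` of the new generators. -/
def BoundedBy (m : ℕ) (t : L.Term (α ⊕ ℕ)) : Prop :=
  ∃ t' : L.Term (α ⊕ Fin m), t'.relabel (Sum.map id Fin.val) = t

theorem BoundedBy.mono {m m' : ℕ} (h : m ≤ m') {t : L.Term (α ⊕ ℕ)} :
    BoundedBy m t → BoundedBy m' t := by
  rintro ⟨t', rfl⟩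
  refine ⟨t'.relabel (Sum.map id (Fin.castLE h)), ?_⟩
  rw [Term.relabel_relabel]
  congr 1
  ext (x | x) <;> rfl

theorem boundedBy_inl (m : ℕ) (t : L.Term α) : BoundedBy m (t.relabel Sum.inl : L.Term (α ⊕ ℕ)) :=
  ⟨t.relabel Sum.inl, by rw [Term.relabel_relabel]; rfl⟩

theorem boundedBy_inr {m z : ℕ} (h : z < m) : BoundedBy m (.var (.inr z) : L.Term (α ⊕ ℕ)) :=
  ⟨.var (.inr ⟨z, h⟩), rfl⟩

theorem boundedBy_realize {m : ℕ} {t : L.Term β} {σ : β → L.Term (α ⊕ ℕ)}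
    (h : ∀ x, BoundedBy m (σ x)) : BoundedBy m (t.realize σ) := by
  induction t with
  | var x => exact h x
  | func f ts ih =>
    choose ts' h' using ih
    exact ⟨.func f ts', by simp only [Term.relabel, h']; rfl⟩

end Terms

/-! ### Nodes and provability, and the passage from provability to coverings -/

section Nodes

variable {L : FirstOrder.Language.{u, v}} {α : Type w}

/-- A node of a covering, with the new generators numbered by `ℕ`: their number, and the set of
relations. -/
abbrev Node (L : FirstOrder.Language.{u, v}) (α : Type w) := ℕ × Set (Atom L (α ⊕ ℕ))

/-- The child of a node that corresponds to a disjunct of an axiom. -/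
def Node.child {n : ℕ} (p : Node L α) (σ : Fin n → L.Term (α ⊕ ℕ)) (d : Disjunct L n) : Node L α :=
  (p.1 + d.arity,
    p.2 ∪ {A | A ∈ d.atoms.map
      (Atom.subst (Sum.elim σ fun z : Fin d.arity => .var (.inr (p.1 + z))))})

theorem Node.le_child {n : ℕ} (p : Node L α) (σ : Fin n → L.Term (α ⊕ ℕ)) (d : Disjunct L n) :
    p ≤ p.child σ d := ⟨Nat.le_add_right _ _, Set.subset_union_left⟩

/-- There is a covering below the node at each leaf of which `B` holds. -/
inductive Provable (D : DynTheory L) (B : Atom L α) : Node L α → Prop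
  | leaf {p : Node L α} (h : B.relabel Sum.inl ∈ p.2) : Provable D B p
  | branch {p : Node L α} (a : DynAxiom L) (mem : a ∈ D.withEq) (σ : Fin a.n → L.Term (α ⊕ ℕ))
      (bdd : ∀ j, BoundedBy p.1 (σ j)) (hyp : ∀ A ∈ a.hyp, A.subst σ ∈ p.2)
      (children : ∀ d ∈ a.concl, Provable D B (p.child σ d)) : Provable D B p

theorem sumMap_val_injective (α : Type w) (m : ℕ) :
    Function.Injective (Sum.map id Fin.val : α ⊕ Fin m → α ⊕ ℕ) :=
  Sum.map_injective.2 ⟨Function.injective_id, Fin.val_injective⟩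

theorem relabel_sumMap_val_castAdd {m k : ℕ} (A : Atom L (α ⊕ Fin m)) :
    (A.relabel (Sum.map id (Fin.castAdd k))).relabel (Sum.map id Fin.val) =
      A.relabel (Sum.map id Fin.val) := by
  simp only [Atom.relabel_eq_subst, Atom.subst_subst, Term.subst]
  congr 1
  ext (x | x) <;> rfl

theorem subst_sumElim_relabel {m n k : ℕ} (A : Atom L (Fin n ⊕ Fin k))
    (σ : Fin n → L.Term (α ⊕ Fin m)) :
    (A.subst (Sum.elim (fun j => (σ j).relabel (Sum.map id (Fin.castAdd k)))
      (fun z => .var (.inr (Fin.natAdd m z))))).relabel (Sum.map id Fin.val) =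
    A.subst (Sum.elim (fun j => (σ j).relabel (Sum.map id Fin.val))
      fun z : Fin k => .var (.inr (m + z))) := by
  simp only [Atom.relabel_eq_subst, Atom.subst_subst, relabel_eq_subst]
  congr 1
  ext (x | x)
  · simp only [Sum.elim_inl, term_subst_subst]
    congr 1
    ext (x | x) <;> rfl
  · rfl

theorem child_subset {m n : ℕ} {S : Set (Atom L (α ⊕ ℕ))} {S' : Set (Atom L (α ⊕ Fin m))}
    (h : S ⊆ Atom.relabel (Sum.map id Fin.val) '' S') (σ : Fin n → L.Term (α ⊕ Fin m))
    (d : Disjunct L n) :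
    (Node.child (m, S) (fun j => (σ j).relabel (Sum.map id Fin.val)) d).2 ⊆
      Atom.relabel (Sum.map id Fin.val) '' extend S' σ d := by
  rintro A (hA | hA)
  · obtain ⟨A', hA', rfl⟩ := h hA
    exact ⟨_, Or.inl ⟨A', hA', rfl⟩, relabel_sumMap_val_castAdd A'⟩
  · obtain ⟨A', hA', rfl⟩ := List.mem_map.1 hA
    exact ⟨_, Or.inr (List.mem_map.2 ⟨A', hA', rfl⟩), subst_sumElim_relabel A' σ⟩

/-- Numbering the new generators by `ℕ` keeps all nodes in one ordered type; here the bounds are put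
back into the types. An inclusion of the relations suffices, since further relations never hurt a
covering. No `alg` node is needed: an algebraic axiom is a branching with one child and no new
generator. -/
theorem Provable.exists_covering {D : DynTheory L} {B : Atom L α} {p : Node L α}
    (h : Provable D B p) (S' : Set (Atom L (α ⊕ Fin p.1)))
    (hS : p.2 ⊆ Atom.relabel (Sum.map id Fin.val) '' S') :
    ∃ τ : Covering D p.1 S', τ.Proves B := by
  induction h with
  | @leaf p h =>
    refine ⟨.leaf, ?_⟩
    obtain ⟨A, hA, hAB⟩ := hS h
    have : A = B.relabel Sum.inl := by
      apply Atom.relabel_injective (sumMap_val_injective α p.1)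
      rw [hAB]
      simp only [Atom.relabel_eq_subst, Atom.subst_subst]
      rfl
    rw [this] at hA
    exact hA
  | @branch p a mem σ bdd hyp children ih =>
    -- Bounded terms are those that come from terms over `α ⊕ Fin p.1`, as `branch` requires.
    choose σ' hσ' using bdd
    obtain rfl : (fun j => (σ' j).relabel (Sum.map id Fin.val)) = σ := funext hσ'
    have hyp' : ∀ A ∈ a.hyp, A.subst σ' ∈ S' := fun A hA => by
      obtain ⟨A', hA', h⟩ := hS (hyp A hA)
      have : A' = A.subst σ' := by
        apply Atom.relabel_injective (sumMap_val_injective α p.1)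
        rw [h]
        simp only [Atom.relabel_eq_subst, Atom.subst_subst, relabel_eq_subst]
      exact this ▸ hA'
    have hc : ∀ i : Fin a.concl.length, ∃ τ : Covering D (p.1 + (a.concl.get i).arity)
        (extend S' σ' (a.concl.get i)), τ.Proves B := fun i =>
      ih _ (List.get_mem _ _) _ (child_subset hS σ' _)
    choose τ hτ using hc
    exact ⟨.branch a mem σ' hyp' τ, hτ⟩

end Nodes

/-! ### Forcing with `⊥` read as provability of `B` -/

section Forcing

variable {L : FirstOrder.Language.{u, v}} {α : Type w} {V : Type w'}

attribute [local instance] termStructure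

/-- The double negation of `X`, in the sense of the Beth semantics in which `⊥` is the provability
of `B`. -/
def DNeg (D : DynTheory L) (B : Atom L α) (X : Node L α → Prop) (p : Node L α) : Prop :=
  ∀ q ≥ p, (∀ r ≥ q, X r → Provable D B r) → Provable D B q

/-- The predicate `X` on nodes is persistent and equivalent to its double negation. -/
structure Stable (D : DynTheory L) (B : Atom L α) (X : Node L α → Prop) : Prop where
  mono : ∀ {p q}, p ≤ q → X p → X q
  of_dneg : ∀ {p}, DNeg D B X p → X p

variable {D : DynTheory L} {B : Atom L α}

theorem DNeg.mono {X : Node L α → Prop} {p q : Node L α} (h : p ≤ q) (hp : DNeg D B X p) :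
    DNeg D B X q := fun r hr => hp r (h.trans hr)

theorem DNeg.of {X : Node L α → Prop} {p : Node L α} (h : ∀ q ≥ p, X q) : DNeg D B X p :=
  fun q hq hk => hk q le_rfl (h q hq)

/-- `DNeg` is the continuation monad with answers in `Provable`. A doubly negated hypothesis may be
used as if it held, at the price of passing to an extension, whenever the conclusion is doubly
negated. -/
theorem DNeg.bind {X Y : Node L α → Prop} {p : Node L α} (hX : DNeg D B X p)
    (h : ∀ q ≥ p, X q → DNeg D B Y q) : DNeg D B Y p := fun q hq hk =>
  hX q hq fun r hr hXr => h r (hq.trans hr) hXr r le_rfl fun s hs => hk s (hr.trans hs)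

theorem DNeg.stable (X : Node L α → Prop) : Stable D B (DNeg D B X) where
  mono := DNeg.mono
  of_dneg h := h.bind fun _ _ h => h

/-- The relation `A` holds, up to a double negation. -/
abbrev Holds (D : DynTheory L) (B : Atom L α) (A : Atom L (α ⊕ ℕ)) : Node L α → Prop :=
  DNeg D B fun p => A ∈ p.2

theorem DNeg.forall_mem {l : List (Atom L (α ⊕ ℕ))} {p : Node L α}
    (h : ∀ A ∈ l, Holds D B A p) : DNeg D B (fun q => ∀ A ∈ l, A ∈ q.2) p := by
  induction l with
  | nil => exact .of fun _ _ _ h => absurd h List.not_mem_nil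
  | cons A l ih =>
    rw [List.forall_mem_cons] at h
    refine h.1.bind fun q hq hA => ((ih h.2).mono hq).bind fun r hr hl => .of fun s hs => ?_
    exact List.forall_mem_cons.2 ⟨(hr.trans hs).2 hA, fun A' hA' => hs.2 (hl A' hA')⟩

/-- The rule of inference given by a dynamical axiom, for stable conclusions. -/
theorem Stable.of_rule {X : Node L α → Prop} (hX : Stable D B X) {p : Node L α} {a : DynAxiom L}
    (mem : a ∈ D.withEq) {σ : Fin a.n → L.Term (α ⊕ ℕ)} (bdd : ∀ j, BoundedBy p.1 (σ j))
    (hyp : ∀ A ∈ a.hyp, Holds D B (A.subst σ) p)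
    (h : ∀ d ∈ a.concl, ∀ q ≥ p, ∀ zs : Fin d.arity → L.Term (α ⊕ ℕ), (∀ z, BoundedBy q.1 (zs z)) →
      (∀ A ∈ d.atoms, A.subst (Sum.elim σ zs) ∈ q.2) → X q) : X p := by
  refine hX.of_dneg fun q hq hk => ?_
  have hyp' : ∀ A ∈ a.hyp.map (Atom.subst σ), Holds D B A p := by simpa using hyp
  -- To prove `q` provable it may be assumed that the hypotheses of the axiom are actual relations,
  -- at an extension `r`. There the axiom is applied, and each child satisfies `X`, hence is
  -- provable by `hk`.
  refine DNeg.forall_mem hyp' q hq fun r hr hyp => ?_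
  refine .branch a mem σ (fun j => (bdd j).mono (hq.trans hr).1) (by simpa using hyp) fun d hd => ?_
  refine hk _ (hr.trans (r.le_child σ d)) (h d hd _ ((hq.trans hr).trans (r.le_child σ d)) _
    (fun z => boundedBy_inr (Nat.add_lt_add_left z.2 _)) fun A hA => ?_)
  exact Or.inr (List.mem_map_of_mem hA)

theorem holds_of_algebraic {n : ℕ} {H : List (Atom L (Fin n))} {K : Atom L (Fin n)}
    (mem : DynAxiom.algebraic H K ∈ D.withEq) {p : Node L α} {σ : Fin n → L.Term (α ⊕ ℕ)}
    (bdd : ∀ j, BoundedBy p.1 (σ j)) (hyp : ∀ A ∈ H, Holds D B (A.subst σ) p) :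
    Holds D B (K.subst σ) p := by
  refine (DNeg.stable _).of_rule mem bdd hyp fun d hd q hq zs _ h => .of fun r hr => hr.2 ?_
  obtain rfl := List.mem_singleton.1 hd
  have := h _ (List.mem_singleton.2 rfl)
  rwa [Atom.relabel_eq_subst, Atom.subst_subst] at this

/-- Forcing of a formula at a node, for an assignment of terms to its variables. -/
def Forces (D : DynTheory L) (B : Atom L α) : {n : ℕ} → L.BoundedFormula V n →
    (V → L.Term (α ⊕ ℕ)) → (Fin n → L.Term (α ⊕ ℕ)) → Node L α → Prop
  | _, .falsum, _, _ => DNeg D B fun _ => False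
  | _, .equal s t, v, xs =>
    Holds D B (.equal (s.realize (Sum.elim v xs)) (t.realize (Sum.elim v xs)))
  | _, .rel r ts, v, xs => Holds D B (.rel r fun i => (ts i).realize (Sum.elim v xs))
  | _, .imp φ ψ, v, xs => fun p => ∀ q ≥ p, Forces D B φ v xs q → Forces D B ψ v xs q
  | _, .all φ, v, xs => fun p =>
    ∀ q ≥ p, ∀ t, BoundedBy q.1 t → Forces D B φ v (Fin.snoc xs t) q

/-- `DNeg` values are stable, and stability passes through `→` and `∀` because a doubly negated
implication or generalization can be applied under the double negation. No other connective is
primitive, so this makes the semantics classical. -/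
theorem Forces.stable {n : ℕ} (φ : L.BoundedFormula V n) (v : V → L.Term (α ⊕ ℕ))
    (xs : Fin n → L.Term (α ⊕ ℕ)) : Stable D B (Forces D B φ v xs) := by
  induction φ with
  | falsum => exact DNeg.stable _
  | equal => exact DNeg.stable _
  | rel => exact DNeg.stable _
  | imp φ ψ ih' ih =>
    refine ⟨fun h hp r hr => hp r (h.trans hr), fun h q hq hφ => (ih xs).of_dneg ?_⟩
    exact (h.mono hq).bind fun r hr hi => .of fun s hs =>
      hi s hs ((ih' xs).mono (hr.trans hs) hφ)
  | all φ ih =>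
    refine ⟨fun h hp r hr => hp r (h.trans hr), fun h q hq t ht => (ih _).of_dneg ?_⟩
    exact (h.mono hq).bind fun r hr hi => .of fun s hs =>
      hi s hs t (ht.mono (hr.trans hs).1)

theorem Forces.mono {n : ℕ} {φ : L.BoundedFormula V n} {v : V → L.Term (α ⊕ ℕ)}
    {xs : Fin n → L.Term (α ⊕ ℕ)} {p q : Node L α} (h : p ≤ q) :
    Forces D B φ v xs p → Forces D B φ v xs q := (Forces.stable φ v xs).mono h

/-- Ex falso: where `⊥` is forced all extensions are provable, so every double negation holds. -/
theorem Forces.of_falsum {n : ℕ} {v : V → L.Term (α ⊕ ℕ)} {xs : Fin n → L.Term (α ⊕ ℕ)}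
    {X : Node L α → Prop} (hX : Stable D B X) {p : Node L α}
    (h : Forces D B (⊥ : L.BoundedFormula V n) v xs p) : X p :=
  hX.of_dneg (DNeg.bind h fun _ _ h => h.elim)

section Substitution

variable {W : Type*}

theorem forces_mapTermRel_id {ft : ∀ n, L.Term (V ⊕ Fin n) → L.Term (W ⊕ Fin n)} {n : ℕ}
    {φ : L.BoundedFormula V n} {v : V → L.Term (α ⊕ ℕ)} {v' : W → L.Term (α ⊕ ℕ)}
    {xs : Fin n → L.Term (α ⊕ ℕ)}
    (h : ∀ n t (xs : Fin n → L.Term (α ⊕ ℕ)),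
      (ft n t).realize (Sum.elim v' xs) = t.realize (Sum.elim v xs)) :
    Forces D B (φ.mapTermRel ft (fun _ => id) fun _ => id) v' xs = Forces D B φ v xs := by
  induction φ with
  | falsum => rfl
  | equal => simp only [BoundedFormula.mapTermRel, Forces, h]
  | rel => simp only [BoundedFormula.mapTermRel, Forces, h, id]
  | imp _ _ ih1 ih2 => simp only [BoundedFormula.mapTermRel, Forces, ih1, ih2]
  | all _ ih => simp only [BoundedFormula.mapTermRel, Forces, ih, id]

theorem forces_subst {n : ℕ} {φ : L.BoundedFormula V n} {σ : V → L.Term W}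
    {v : W → L.Term (α ⊕ ℕ)} {xs : Fin n → L.Term (α ⊕ ℕ)} :
    Forces D B (φ.subst σ) v xs = Forces D B φ (fun x => (σ x).realize v) xs :=
  forces_mapTermRel_id fun n t xs => by
    rw [Term.realize_subst]
    congr 1
    ext (x | x)
    · simp only [Sum.elim_inl, Function.comp_apply, Term.realize_relabel, Sum.elim_comp_inl]
    · rfl

theorem forces_castLE {m n : ℕ} (h : m = n) {h' : m ≤ n} {φ : L.BoundedFormula V m}
    {v : V → L.Term (α ⊕ ℕ)} {xs : Fin n → L.Term (α ⊕ ℕ)} :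
    Forces D B (φ.castLE h') v xs = Forces D B φ v (xs ∘ Fin.cast h) := by
  subst h
  simp only [BoundedFormula.castLE_rfl, Fin.cast_refl, Function.comp_id]

theorem forces_mapTermRel_add_castLE {k : ℕ}
    {ft : ∀ n, L.Term (V ⊕ Fin n) → L.Term (W ⊕ Fin (k + n))} {n : ℕ} {φ : L.BoundedFormula V n}
    (v : ∀ {n}, (Fin (k + n) → L.Term (α ⊕ ℕ)) → V → L.Term (α ⊕ ℕ)) {v' : W → L.Term (α ⊕ ℕ)}
    (xs : Fin (k + n) → L.Term (α ⊕ ℕ))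
    (h : ∀ n t (xs' : Fin (k + n) → L.Term (α ⊕ ℕ)),
      (ft n t).realize (Sum.elim v' xs') = t.realize (Sum.elim (v xs') (xs' ∘ Fin.natAdd _)))
    (hv : ∀ n (xs : Fin (k + n) → L.Term (α ⊕ ℕ)) (x : L.Term (α ⊕ ℕ)),
      @v (n + 1) (Fin.snoc xs x : Fin _ → L.Term (α ⊕ ℕ)) = v xs) :
    Forces D B (φ.mapTermRel ft (fun _ => id)
      fun _ => BoundedFormula.castLE (add_assoc _ _ _).symm.le) v' xs =
      Forces D B φ (v xs) (xs ∘ Fin.natAdd _) := by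
  induction φ with
  | falsum => rfl
  | equal => simp only [BoundedFormula.mapTermRel, Forces, h]
  | rel => simp only [BoundedFormula.mapTermRel, Forces, h, id]
  | imp _ _ ih1 ih2 => simp only [BoundedFormula.mapTermRel, Forces, ih1, ih2]
  | all _ ih =>
    simp only [BoundedFormula.mapTermRel, Forces, forces_castLE (add_assoc _ _ _).symm,
      Fin.cast_refl, Function.comp_id, ih, hv, Fin.snoc_comp_natAdd]

theorem forces_relabel {m n : ℕ} {φ : L.BoundedFormula V n} {g : V → W ⊕ Fin m}
    {v : W → L.Term (α ⊕ ℕ)} {xs : Fin (m + n) → L.Term (α ⊕ ℕ)} :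
    Forces D B (φ.relabel g) v xs =
      Forces D B φ (Sum.elim v (xs ∘ Fin.castAdd n) ∘ g) (xs ∘ Fin.natAdd m) :=
  forces_mapTermRel_add_castLE (fun xs => Sum.elim v (xs ∘ Fin.castAdd _) ∘ g) xs
    (fun n t xs' => by rw [Term.realize_relabel, BoundedFormula.sumElim_comp_relabelAux])
    fun _ _ _ => by simp

theorem forces_toFormula {n : ℕ} (φ : L.BoundedFormula V n) (v : V ⊕ Fin n → L.Term (α ⊕ ℕ))
    {ys : Fin 0 → L.Term (α ⊕ ℕ)} :
    Forces D B φ.toFormula v ys = Forces D B φ (v ∘ Sum.inl) (v ∘ Sum.inr) := by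
  induction φ with
  | falsum => rfl
  | equal => simp only [BoundedFormula.toFormula, Term.equal, Term.bdEqual, Forces,
      Term.realize_relabel, Sum.elim_comp_inl, Sum.elim_comp_inl_inr]
  | rel => simp only [BoundedFormula.toFormula, Relations.formula, Relations.boundedFormula, Forces,
      Term.realize_relabel, Sum.elim_comp_inl, Sum.elim_comp_inl_inr]
  | imp _ _ ih1 ih2 =>
    rw [BoundedFormula.toFormula]
    simp only [Forces, ih1, ih2]
  | all φ ih =>
    rw [BoundedFormula.toFormula]
    funext p
    simp only [Forces]
    refine forall_congr fun q => forall_congr fun hq => forall_congr fun t =>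
      forall_congr fun ht => ?_
    have h := ih (Sum.elim (v ∘ Sum.inl) (Fin.snoc (v ∘ Sum.inr) t))
    simp only [Sum.elim_comp_inl, Sum.elim_comp_inr] at h
    rw [← h]
    refine (congrFun (forces_relabel (m := 1) (n := 0)) q).trans ?_
    refine congrFun (congrArg₂ _ ?_ (Subsingleton.elim _ _)) q
    ext1 x
    -- A variable of `φ` is free, or the quantified one, which is the last, or one of the `n`
    -- earlier de Bruijn variables, which `toFormula` makes free.
    rcases x with x | x
    · simp
    · refine Fin.lastCases ?_ (fun i => ?_) x
      · simp [Fin.snoc]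
      · simp only [Fin.castSucc, Function.comp_apply, Sum.elim_inr,
          finSumFinEquiv_symm_apply_castAdd, Sum.map_inl, Sum.elim_inl]
        rw [← Fin.castSucc]
        simp

theorem forces_inst {φ : L.BoundedFormula V 1} {t : L.Term V} {v : V → L.Term (α ⊕ ℕ)}
    {xs : Fin 0 → L.Term (α ⊕ ℕ)} :
    Forces D B (inst φ t) v xs = Forces D B φ v fun _ => t.realize v := by
  rw [inst, forces_subst, forces_toFormula]
  rfl

end Substitution

theorem forces_congr_of_eqOn {n : ℕ} [DecidableEq V] (φ : L.BoundedFormula V n)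
    {v v' : V → L.Term (α ⊕ ℕ)} {xs : Fin n → L.Term (α ⊕ ℕ)}
    (h : ∀ x ∈ φ.freeVarFinset, v x = v' x) : Forces D B φ v xs = Forces D B φ v' xs := by
  have key : ∀ {n} (t : L.Term (V ⊕ Fin n)) (xs : Fin n → L.Term (α ⊕ ℕ)),
      (∀ x ∈ t.varFinsetLeft, v x = v' x) →
      t.realize (Sum.elim v xs) = t.realize (Sum.elim v' xs) := by
    intro n t xs
    induction t with
    | var x =>
      rcases x with x | x
      · exact fun h => h x (by simp [Term.varFinsetLeft])
      · exact fun _ => rfl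
    | func f ts ih =>
      intro h
      simp only [Term.realize]
      congr 1
      funext i
      exact ih i fun x hx => h x (by simpa [Term.varFinsetLeft] using ⟨i, hx⟩)
  induction φ with
  | falsum => rfl
  | equal s t =>
    simp only [BoundedFormula.freeVarFinset, Finset.mem_union] at h
    simp only [Forces, key s xs fun x hx => h x (.inl hx), key t xs fun x hx => h x (.inr hx)]
  | rel r ts =>
    simp only [Forces]
    have : ∀ i, (ts i).realize (Sum.elim v xs) = (ts i).realize (Sum.elim v' xs) := fun i =>
      key (ts i) xs fun x hx => h x (by simpa [BoundedFormula.freeVarFinset] using ⟨i, hx⟩)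
    simp only [this]
  | imp _ _ ih1 ih2 =>
    simp only [BoundedFormula.freeVarFinset, Finset.mem_union] at h
    simp only [Forces, ih1 fun x hx => h x (.inl hx), ih2 fun x hx => h x (.inr hx)]
  | all _ ih => simp only [Forces, ih h]

theorem Fresh.forces_update {x : V} {n : ℕ} {φ : L.BoundedFormula V n} [DecidableEq V]
    (h : Fresh x φ) (v : V → L.Term (α ⊕ ℕ)) (t : L.Term (α ⊕ ℕ)) (xs : Fin n → L.Term (α ⊕ ℕ)) :
    Forces D B φ (Function.update v x t) xs = Forces D B φ v xs := by
  classical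
  refine forces_congr_of_eqOn φ fun y hy => Function.update_of_ne ?_ _ _
  rintro rfl
  exact h (by convert hy)

end Forcing

/-! ### Equality is a congruence for forcing -/

section Equality

variable {L : FirstOrder.Language.{u, v}} {α : Type w} {V : Type w'} {D : DynTheory L}
  {B : Atom L α}

attribute [local instance] termStructure

/-- The assignments `v` and `v'` take values at the node `p` that are equal there. -/
def EqAt (D : DynTheory L) (B : Atom L α) (v v' : V → L.Term (α ⊕ ℕ)) (p : Node L α) : Prop :=
  ∀ x, BoundedBy p.1 (v x) ∧ BoundedBy p.1 (v' x) ∧ Holds D B (.equal (v x) (v' x)) p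

theorem holds_refl {p : Node L α} {t : L.Term (α ⊕ ℕ)} (h : BoundedBy p.1 t) :
    Holds D B (.equal t t) p :=
  holds_of_algebraic (Or.inr IsEqAxiom.refl) (σ := fun _ => t) (fun _ => h) (by simp)

theorem holds_symm {p : Node L α} {s t : L.Term (α ⊕ ℕ)} (hs : BoundedBy p.1 s)
    (ht : BoundedBy p.1 t) (h : Holds D B (.equal s t) p) : Holds D B (.equal t s) p :=
  holds_of_algebraic (Or.inr IsEqAxiom.symm) (σ := ![s, t]) (by simp [Fin.forall_fin_two, hs, ht])
    (by simpa [Atom.subst, Term.subst] using h)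

theorem EqAt.mono {v v' : V → L.Term (α ⊕ ℕ)} {p q : Node L α} (hpq : p ≤ q)
    (h : EqAt D B v v' p) : EqAt D B v v' q := fun x =>
  ⟨(h x).1.mono hpq.1, (h x).2.1.mono hpq.1, (h x).2.2.mono hpq⟩

theorem EqAt.refl {v : V → L.Term (α ⊕ ℕ)} {p : Node L α} (h : ∀ x, BoundedBy p.1 (v x)) :
    EqAt D B v v p := fun x => ⟨h x, h x, holds_refl (h x)⟩

theorem EqAt.symm {v v' : V → L.Term (α ⊕ ℕ)} {p : Node L α} (h : EqAt D B v v' p) :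
    EqAt D B v' v p := fun x => ⟨(h x).2.1, (h x).1, holds_symm (h x).1 (h x).2.1 (h x).2.2⟩

theorem EqAt.snoc {n : ℕ} {xs xs' : Fin n → L.Term (α ⊕ ℕ)} {p : Node L α}
    (h : EqAt D B xs xs' p) {t : L.Term (α ⊕ ℕ)} (ht : BoundedBy p.1 t) :
    EqAt D B (Fin.snoc xs t : Fin (n + 1) → _) (Fin.snoc xs' t : Fin (n + 1) → _) p := fun i => by
  refine Fin.lastCases ?_ (fun i => ?_) i
  · simpa using ⟨ht, holds_refl ht⟩
  · simpa using h i

theorem EqAt.sumElim {n : ℕ} {v v' : V → L.Term (α ⊕ ℕ)} {xs xs' : Fin n → L.Term (α ⊕ ℕ)}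
    {p : Node L α} (hv : EqAt D B v v' p) (hxs : EqAt D B xs xs' p) :
    EqAt D B (Sum.elim v xs) (Sum.elim v' xs') p := Sum.rec hv hxs

theorem EqAt.bounded_append {n : ℕ} {ts ts' : Fin n → L.Term (α ⊕ ℕ)} {p : Node L α}
    (h : EqAt D B ts ts' p) (j : Fin (n + n)) : BoundedBy p.1 (Fin.append ts ts' j) := by
  refine Fin.addCases (fun i => ?_) (fun i => ?_) j
  · rw [Fin.append_left]; exact (h i).1
  · rw [Fin.append_right]; exact (h i).2.1

theorem EqAt.func {n : ℕ} (f : L.Functions n) {ts ts' : Fin n → L.Term (α ⊕ ℕ)} {p : Node L α}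
    (h : EqAt D B ts ts' p) : Holds D B (.equal (.func f ts) (.func f ts')) p := by
  have := holds_of_algebraic (Or.inr (IsEqAxiom.func f)) h.bounded_append (D := D) (B := B) (by
    simpa [List.mem_ofFn, Atom.subst, Term.subst, -Fin.natAdd_eq_addNat] using fun i => (h i).2.2)
  simpa [Atom.subst, Term.subst, -Fin.natAdd_eq_addNat] using this

theorem EqAt.rel {n : ℕ} (r : L.Relations n) {ts ts' : Fin n → L.Term (α ⊕ ℕ)} {p : Node L α}
    (h : EqAt D B ts ts' p) (hr : Holds D B (.rel r ts) p) : Holds D B (.rel r ts') p := by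
  have := holds_of_algebraic (Or.inr (IsEqAxiom.rel r)) h.bounded_append (D := D) (B := B) (by
    simpa [List.mem_ofFn, Atom.subst, Term.subst, -Fin.natAdd_eq_addNat] using
      ⟨hr, fun i => (h i).2.2⟩)
  simpa [Atom.subst, Term.subst, -Fin.natAdd_eq_addNat] using this

theorem EqAt.realize {v v' : V → L.Term (α ⊕ ℕ)} {p : Node L α} (h : EqAt D B v v' p)
    {I : Type*} (ts : I → L.Term V) :
    EqAt D B (fun i => (ts i).realize v) (fun i => (ts i).realize v') p := fun i =>
  ⟨boundedBy_realize fun x => (h x).1, boundedBy_realize fun x => (h x).2.1, by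
    dsimp only
    induction ts i with
    | var x => exact (h x).2.2
    | func f ts ih =>
      exact EqAt.func f fun i => ⟨boundedBy_realize fun x => (h x).1,
        boundedBy_realize fun x => (h x).2.1, ih i⟩⟩

theorem EqAt.equal {s t s' t' : L.Term (α ⊕ ℕ)} {p : Node L α}
    (h : EqAt D B ![s, t] ![s', t'] p) (hst : Holds D B (.equal s t) p) :
    Holds D B (.equal s' t') p := by
  have htrans : ∀ {a b c : L.Term (α ⊕ ℕ)}, BoundedBy p.1 a → BoundedBy p.1 b → BoundedBy p.1 c →
      Holds D B (.equal a b) p → Holds D B (.equal b c) p → Holds D B (.equal a c) p := by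
    intro a b c ha hb hc hab hbc
    exact holds_of_algebraic (Or.inr IsEqAxiom.trans) (σ := ![a, b, c])
      (by simp [Fin.forall_fin_succ, ha, hb, hc])
      (by simpa [Atom.subst, Term.subst] using ⟨hab, hbc⟩)
  have h0 := h 0
  have h1 := h 1
  simp only [Matrix.cons_val_zero, Matrix.cons_val_one] at h0 h1
  exact htrans h0.2.1 h0.1 h1.2.1 (holds_symm h0.1 h0.2.1 h0.2.2)
    (htrans h0.1 h1.1 h1.2.1 hst h1.2.2)

/-- Leibniz's rule. Atomic formulas are handled by the equality axioms, applied as rules at the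
node; the premise of an implication is contravariant and uses symmetry. -/
theorem EqAt.forces {n : ℕ} (φ : L.BoundedFormula V n) {v v' : V → L.Term (α ⊕ ℕ)}
    {xs xs' : Fin n → L.Term (α ⊕ ℕ)} {p : Node L α} (hv : EqAt D B v v' p)
    (hxs : EqAt D B xs xs' p) (h : Forces D B φ v xs p) : Forces D B φ v' xs' p := by
  induction φ generalizing v v' p with
  | falsum => exact h
  | equal s t =>
    refine EqAt.equal (fun i => ?_) h
    have := (hv.sumElim hxs).realize ![s, t] i
    fin_cases i <;> exact this
  | rel r ts => exact EqAt.rel r ((hv.sumElim hxs).realize ts) h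
  | imp φ ψ ih1 ih2 =>
    exact fun q hq hφ => ih2 (hv.mono hq) (hxs.mono hq)
      (h q hq (ih1 (hv.mono hq).symm (hxs.mono hq).symm hφ))
  | all φ ih =>
    exact fun q hq t ht => ih (hv.mono hq) ((hxs.mono hq).snoc ht) (h q hq t ht)

end Equality

/-! ### Soundness of natural deduction and the existence of dynamical proofs -/

section Soundness

variable {L : FirstOrder.Language.{u, v}} {α : Type w} {V : Type w'} {D : DynTheory L}
  {B : Atom L α}

attribute [local instance] termStructure

theorem Derivation.forces {Γ : List (L.Formula V)} {φ : L.Formula V} (d : Derivation Γ φ)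
    {v : V → L.Term (α ⊕ ℕ)} {xs : Fin 0 → L.Term (α ⊕ ℕ)} {p : Node L α}
    (hv : ∀ x, BoundedBy p.1 (v x)) (hΓ : ∀ ψ ∈ Γ, Forces D B ψ v xs p) :
    Forces D B φ v xs p := by
  classical
  induction d generalizing v p with
  | ax h => exact hΓ _ h
  | impIntro d ih =>
    exact fun q hq hφ => ih (fun x => (hv x).mono hq.1)
      (List.forall_mem_cons.2 ⟨hφ, fun ψ hψ => (hΓ ψ hψ).mono hq⟩)
  | impElim d e ih1 ih2 => exact ih1 hv hΓ p le_rfl (ih2 hv hΓ)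
  | @raa Γ φ d ih =>
    -- By stability it is enough to prove `q` provable when `φ` entails provability above `q`. The
    -- latter says that `q` forces `¬φ`, so `q` forces `⊥`, and this yields provability at `q`
    -- itself.
    refine (Forces.stable φ v xs).of_dneg fun q hq hk => ?_
    refine ih (fun x => (hv x).mono hq.1) (List.forall_mem_cons.2
      ⟨fun r hr hφ => ?_, fun ψ hψ => (hΓ ψ hψ).mono hq⟩) q le_rfl fun _ _ h => h.elim
    exact fun s hs _ => hk s (hr.trans hs) (hφ.mono hs)
  | @allIntro Γ φ x hφ hΓx d ih =>
    intro q hq t ht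
    -- The eigenvariable is reassigned to the arbitrary term `t`; freshness keeps the context forced
    -- and `φ` unaffected.
    have hv' : ∀ y, BoundedBy q.1 (Function.update v x t y) := fun y => by
      by_cases h : y = x
      · subst h; simpa using ht
      · simpa [h] using (hv y).mono hq.1
    have := ih hv' fun ψ hψ => by
      rw [(hΓx ψ hψ).forces_update]
      exact (hΓ ψ hψ).mono hq
    rw [forces_inst, hφ.forces_update] at this
    convert this using 1
    ext1 i
    rw [Subsingleton.elim (α := Fin 1) i (Fin.last 0), Fin.snoc_last]
    simp
  | allElim φ t d ih =>
    have := ih hv hΓ p le_rfl _ (boundedBy_realize (t := t) hv)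
    rw [forces_inst]
    convert this using 1
    ext1 i
    rw [Subsingleton.elim (α := Fin 1) i (Fin.last 0), Fin.snoc_last]
  | eqRefl t =>
    simp only [Term.equal, Term.bdEqual, Forces, Term.realize_relabel, Sum.elim_comp_inl]
    exact holds_refl (boundedBy_realize hv)
  | eqSubst φ s t d e ih1 ih2 =>
    have h1 := ih1 hv hΓ
    have h2 := ih2 hv hΓ
    simp only [Term.equal, Term.bdEqual, Forces, Term.realize_relabel, Sum.elim_comp_inl] at h1
    rw [forces_inst] at h2 ⊢
    exact EqAt.forces φ (.refl hv)
      (fun _ => ⟨boundedBy_realize hv, boundedBy_realize hv, h1⟩) h2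

/-- The conjunction is `¬(φ → ¬ψ)`, and stability of `φ` and `ψ` lets them be recovered from it. -/
theorem forces_inf {n : ℕ} {φ ψ : L.BoundedFormula V n} {v : V → L.Term (α ⊕ ℕ)}
    {xs : Fin n → L.Term (α ⊕ ℕ)} {p : Node L α} :
    Forces D B (φ ⊓ ψ) v xs p ↔ Forces D B φ v xs p ∧ Forces D B ψ v xs p := by
  constructor
  · intro h
    refine ⟨(Forces.stable φ v xs).of_dneg fun q hq hk => ?_,
      (Forces.stable ψ v xs).of_dneg fun q hq hk => ?_⟩
    · exact h q hq (fun r hr hφ s hs hψ => fun t ht _ =>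
        hk t ((hr.trans hs).trans ht) (hφ.mono (hs.trans ht))) q le_rfl fun _ _ h => h.elim
    · exact h q hq (fun r hr hφ s hs hψ => fun t ht _ =>
        hk t ((hr.trans hs).trans ht) (hψ.mono ht)) q le_rfl fun _ _ h => h.elim
  · exact fun ⟨hφ, hψ⟩ q hq h => h q le_rfl (hφ.mono hq) q le_rfl (hψ.mono hq)

theorem forces_top {n : ℕ} {v : V → L.Term (α ⊕ ℕ)} {xs : Fin n → L.Term (α ⊕ ℕ)} {p : Node L α} :
    Forces D B (⊤ : L.BoundedFormula V n) v xs p := fun _ _ h => h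

theorem forces_foldr_inf {n : ℕ} {l : List (L.BoundedFormula V n)} {v : V → L.Term (α ⊕ ℕ)}
    {xs : Fin n → L.Term (α ⊕ ℕ)} {p : Node L α} :
    Forces D B (l.foldr (· ⊓ ·) ⊤) v xs p ↔ ∀ φ ∈ l, Forces D B φ v xs p := by
  induction l with
  | nil => simpa using forces_top
  | cons φ l ih => rw [List.foldr_cons, forces_inf, ih, List.forall_mem_cons]

theorem Forces.foldr_sup {n : ℕ} {l : List (L.BoundedFormula V n)} {φ : L.BoundedFormula V n}
    (hφ : φ ∈ l) {v : V → L.Term (α ⊕ ℕ)} {xs : Fin n → L.Term (α ⊕ ℕ)} {p : Node L α}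
    (h : Forces D B φ v xs p) : Forces D B (l.foldr (· ⊔ ·) ⊥) v xs p := by
  induction l with
  | nil => exact absurd hφ List.not_mem_nil
  | cons ψ l ih =>
    intro q hq hn
    rcases List.mem_cons.1 hφ with rfl | hφ
    · exact Forces.of_falsum (Forces.stable _ _ _) (hn q le_rfl (h.mono hq))
    · exact (ih hφ).mono hq

theorem Forces.ex {n : ℕ} {φ : L.BoundedFormula V (n + 1)} {v : V → L.Term (α ⊕ ℕ)}
    {xs : Fin (n + 1) → L.Term (α ⊕ ℕ)} {p : Node L α} (hxs : BoundedBy p.1 (xs (Fin.last n)))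
    (h : Forces D B φ v xs p) : Forces D B φ.ex v (Fin.init xs) p := fun q hq hn => by
  have := hn q le_rfl _ (hxs.mono hq.1)
  rw [Fin.snoc_init_self] at this
  exact this q le_rfl (h.mono hq)

theorem Forces.exsLast {n m : ℕ} {φ : L.BoundedFormula V (n + m)} {v : V → L.Term (α ⊕ ℕ)}
    {xs : Fin (n + m) → L.Term (α ⊕ ℕ)} {p : Node L α} (hxs : ∀ j, BoundedBy p.1 (xs j))
    (h : Forces D B φ v xs p) : Forces D B (exsLast m φ) v (xs ∘ Fin.castAdd m) p := by
  induction m with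
  | zero => exact h
  | succ m ih => exact ih (fun j => hxs j.castSucc) (Forces.ex (hxs _) h)

theorem Forces.alls {n : ℕ} {φ : L.BoundedFormula V n} {v : V → L.Term (α ⊕ ℕ)}
    {ys : Fin 0 → L.Term (α ⊕ ℕ)} {p : Node L α}
    (h : ∀ q ≥ p, ∀ xs : Fin n → L.Term (α ⊕ ℕ), (∀ j, BoundedBy q.1 (xs j)) →
      Forces D B φ v xs q) : Forces D B φ.alls v ys p := by
  induction n with
  | zero => exact h p le_rfl ys fun j => j.elim0
  | succ n ih =>
    refine ih fun q hq xs hxs r hr t ht => h r (hq.trans hr) _ fun j => ?_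
    refine Fin.lastCases ?_ (fun j => ?_) j
    · simpa using ht
    · simpa using (hxs j).mono hr.1

theorem forces_toBounded {β : Type*} {n : ℕ} (A : Atom L β) (g : β → V ⊕ Fin n)
    (v : V → L.Term (α ⊕ ℕ)) (xs : Fin n → L.Term (α ⊕ ℕ)) :
    Forces D B (A.toBounded g) v xs = Holds D B (A.subst fun x => Sum.elim v xs (g x)) := by
  cases A <;>
    simp only [Atom.toBounded, Term.bdEqual, Relations.boundedFormula, Forces, Atom.subst,
      Term.realize_relabel, term_subst_eq_realize] <;> rfl

/-- The conclusion of the axiom, being a formula, is stable, so `Stable.of_rule` reduces it to the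
children. In the child of a disjunct, the new generators are witnesses for the existential
quantifiers. -/
theorem DynAxiom.forces {a : DynAxiom L} (ha : a ∈ D) {v : V → L.Term (α ⊕ ℕ)}
    {ys : Fin 0 → L.Term (α ⊕ ℕ)} {p : Node L α} : Forces D B a.toFormula v ys p := by
  refine Forces.alls fun q hq xs hxs r hr hyp => ?_
  have hxs' : ∀ j, BoundedBy r.1 (xs j) := fun j => (hxs j).mono hr.1
  refine (Forces.stable _ _ _).of_rule (Or.inl ha) hxs' (fun A hA => ?_)
    fun d hd s hs zs hzs hA => ?_
  · have := forces_foldr_inf.1 hyp _ (List.mem_map_of_mem hA)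
    rwa [forces_toBounded] at this
  · refine Forces.foldr_sup (List.mem_map_of_mem hd) ?_
    have hb : ∀ j, BoundedBy s.1 (Fin.append xs zs j) := fun j => by
      refine Fin.addCases (fun i => ?_) (fun i => ?_) j
      · rw [Fin.append_left]; exact (hxs' i).mono hs.1
      · rw [Fin.append_right]; exact hzs i
    have he : Fin.append xs zs ∘ Fin.castAdd d.arity = xs := funext fun i => Fin.append_left _ _ i
    rw [← he]
    refine Forces.exsLast hb (forces_foldr_inf.2 ?_)
    simp only [List.mem_map, forall_exists_index, and_imp, forall_apply_eq_imp_iff₂]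
    intro A hA'
    rw [forces_toBounded]
    refine .of fun t ht => ht.2 ?_
    convert hA A hA' using 2
    ext (i | i)
    · simp
    · simp

/-- A derivation of an atomic formula from dynamical axioms and atomic formulas gives rise to a
covering. -/
theorem Derivation.provable (hterm : Nonempty (L.Term α)) {axs : List (DynAxiom L)}
    {rels : List (Atom L α)} (d : Derivation (axs.map DynAxiom.toFormula ++ rels.map Atom.toFormula)
      B.toFormula) (haxs : ∀ a ∈ axs, a ∈ D) :
    Provable D B (0, {A | A ∈ rels.map (Atom.relabel Sum.inl)}) := by
  obtain ⟨t₀⟩ := hterm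
  -- Generators denote themselves. The further variables of the derivation also need values at the
  -- root, where no new generator exists yet: they all denote `t₀`.
  have hv : ∀ x : α ⊕ ℕ, BoundedBy 0 (Sum.elim (fun a => Term.var (Sum.inl a))
      (fun _ => t₀.relabel Sum.inl) x : L.Term (α ⊕ ℕ)) := by
    rintro (x | x)
    · exact boundedBy_inl 0 (.var x)
    · exact boundedBy_inl 0 t₀
  have key := d.forces (D := D) (B := B) (xs := Fin.elim0)
    (p := (0, {A | A ∈ rels.map (Atom.relabel Sum.inl)})) hv fun ψ hψ => by
      rcases List.mem_append.1 hψ with h | h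
      · obtain ⟨a, ha, rfl⟩ := List.mem_map.1 h
        exact DynAxiom.forces (haxs a ha)
      · obtain ⟨A, hA, rfl⟩ := List.mem_map.1 h
        rw [Atom.toFormula, forces_toBounded]
        refine .of fun q hq => hq.2 (List.mem_map.2 ⟨A, hA, ?_⟩)
        rw [Atom.relabel_eq_subst]
        rfl
  rw [Atom.toFormula, forces_toBounded] at key
  -- The double negation of `B` is unwound by the continuation that stops at a leaf as soon as `B`
  -- is a relation.
  refine key _ le_rfl fun r _ hr => .leaf ?_
  rw [Atom.relabel_eq_subst]
  exact hr

theorem ClassicalProof.nonempty_dynProof (hterm : Nonempty (L.Term α)) {R : Set (Atom L α)}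
    (π : ClassicalProof D R B) : Nonempty (DynProof D R B) := by
  obtain ⟨τ, hτ⟩ := (π.deriv.provable hterm π.axs_mem).exists_covering
    (Atom.relabel (Sum.inl : α → α ⊕ Fin 0) '' R) fun A hA => by
      obtain ⟨A', hA', rfl⟩ := List.mem_map.1 hA
      refine ⟨_, ⟨A', π.rels_mem A' hA', rfl⟩, ?_⟩
      simp only [Atom.relabel_eq_subst, Atom.subst_subst]
      rfl
  exact ⟨⟨τ, hτ⟩⟩

end Soundness

open Encodable

/-! ### Codes of terms as words in prefix notation -/

section Words

variable {L : FirstOrder.Language.{u, v}} [Encodable (Σ n, L.Functions n)] {β : Type w}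
  [Encodable β] {γ : Type w'} [Encodable γ]

theorem encode_map_encode {X : Type*} [Encodable X] (l : List X) :
    encode (l.map encode) = encode l := by
  induction l with
  | nil => rfl
  | cons x l ih => simp [ih]

/-- The list of numbers with the code `c`. -/
def numList (c : ℕ) : List ℕ := (decode c : Option (List ℕ)).getD []

@[simp]
theorem numList_encode (l : List ℕ) : numList (encode l) = l := by simp [numList]

/-- A term in prefix notation, as the list of the codes of its symbols. -/
def word (t : L.Term β) : List ℕ := t.listEncode.map encode

theorem encode_word (t : L.Term β) : encode (word t) = encode t := encode_map_encode _

@[simp]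
theorem numList_encode_term (t : L.Term β) : numList (encode t) = word t := by
  rw [← encode_word, numList_encode]

theorem word_var (x : β) : word (.var x : L.Term β) = [2 * encode x] := rfl

theorem word_func {n : ℕ} (f : L.Functions n) (ts : Fin n → L.Term β) :
    word (.func f ts) =
      (2 * encode (⟨n, f⟩ : Σ n, L.Functions n) + 1) :: (List.ofFn ts).flatMap word := by
  rw [word, Term.listEncode, List.map_cons, List.ofFn_eq_map, List.map_flatMap, List.flatMap_map]
  rfl

/-- Substitution in a term in prefix notation. -/
def substWord (g : ℕ → List ℕ) (l : List ℕ) : List ℕ :=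
  l.flatMap fun s => if s % 2 = 0 then g (s / 2) else [s]

/-- Prefix notation has no brackets, so substitution replaces symbols one by one. Even symbols are
the variables and odd ones the function symbols. -/
theorem substWord_word {g : ℕ → List ℕ} {σ : β → L.Term γ} (h : ∀ x, g (encode x) = word (σ x))
    (t : L.Term β) : substWord g (word t) = word (t.subst σ) := by
  induction t with
  | var x => simp [word_var, substWord, Term.subst, h]
  | func f ts ih =>
    have : ∀ l : List (Fin _), substWord g (l.flatMap fun i => word (ts i)) =
        l.flatMap fun i => word ((ts i).subst σ) := fun l => by
      simp only [substWord, List.flatMap_assoc]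
      exact congrArg (l.flatMap ·) (funext fun i => ih i)
    rw [word_func, Term.subst, word_func, substWord, List.flatMap_cons, List.ofFn_eq_map,
      List.flatMap_map, List.ofFn_eq_map, List.flatMap_map, ← this]
    simp [substWord, Nat.add_mod]

/-- The code of the term in which `g` has been substituted. -/
def substTermCode (g : ℕ → List ℕ) (c : ℕ) : ℕ := encode (substWord g (numList c))

theorem substTermCode_encode {g : ℕ → List ℕ} {σ : β → L.Term γ}
    (h : ∀ x, g (encode x) = word (σ x)) (t : L.Term β) :
    substTermCode g (encode t) = encode (t.subst σ) := by
  rw [substTermCode, numList_encode_term, substWord_word h, encode_word]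

/-- The code of the atomic formula in which `g` has been substituted. -/
def substAtomCode (g : ℕ → List ℕ) (c : ℕ) : ℕ :=
  if c.unpair.1 = 0 then
    Nat.pair 0 (Nat.pair (substTermCode g c.unpair.2.unpair.1)
      (substTermCode g c.unpair.2.unpair.2))
  else
    Nat.pair 1 (Nat.pair c.unpair.2.unpair.1
      (encode ((numList c.unpair.2.unpair.2).map (substTermCode g))))

section Atoms

variable [Encodable (Σ n, L.Relations n)]

theorem substAtomCode_code {g : ℕ → List ℕ} {σ : β → L.Term γ}
    (h : ∀ x, g (encode x) = word (σ x)) (A : Atom L β) :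
    substAtomCode g A.code = (A.subst σ).code := by
  cases A with
  | equal s t => simp [Atom.code, substAtomCode, Atom.subst, substTermCode_encode h]
  | rel r ts =>
    simp [Atom.code, substAtomCode, Atom.subst, List.map_ofFn, Function.comp_def,
      substTermCode_encode h]

theorem Atom.code_injective : Function.Injective (Atom.code : Atom L β → ℕ) := by
  intro A A' h
  cases A <;> cases A' <;> simp only [Atom.code, encode_prod_val, Nat.pair_eq_pair, encode_inj,
    Sigma.mk.injEq, zero_ne_one, one_ne_zero, false_and, true_and] at h
  · rw [h.1, h.2]
  · obtain ⟨⟨rfl, h1⟩, h2⟩ := h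
    obtain rfl := eq_of_heq h1
    congr 1
    funext i
    exact encode_injective (congrFun (List.ofFn_injective h2) i)

end Atoms

variable (L β) in
/-- `s` is the code of a symbol of arity `a`. -/
def IsSymbol (s a : ℕ) : Prop :=
  (a = 0 ∧ ∃ x : β, s = 2 * encode x) ∨
    ∃ f : L.Functions a, s = 2 * encode (⟨a, f⟩ : Σ n, L.Functions n) + 1

/-- The number of the terms of which the word `l` is the concatenation, where `ar` gives the arity
of the symbols. -/
def parse (ar : ℕ → Option ℕ) (l : List ℕ) : Option ℕ :=
  l.foldr (fun s c => c.bind fun k => (ar s).bind fun a => if a ≤ k then some (k - a + 1) else none)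
    (some 0)

/-- The word is read from the right: a symbol of arity `a` takes the first `a` of the terms found so
far as its arguments and makes one term of them. -/
theorem exists_terms_of_parse {ar : ℕ → Option ℕ} (har : ∀ s a, ar s = some a → IsSymbol L β s a)
    {l : List ℕ} {k : ℕ} (h : parse ar l = some k) :
    ∃ ts : List (L.Term β), ts.length = k ∧ ts.flatMap word = l := by
  induction l generalizing k with
  | nil =>
    obtain rfl : 0 = k := by simpa [parse] using h
    exact ⟨[], rfl, rfl⟩
  | cons s l ih =>
    obtain ⟨k', hk', a, ha, hle, rfl⟩ : ∃ k', parse ar l = some k' ∧ ∃ a, ar s = some a ∧ a ≤ k' ∧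
        k' - a + 1 = k := by
      simpa [parse, Option.bind_eq_some_iff] using h
    obtain ⟨ts, rfl, rfl⟩ := ih hk'
    rcases har s a ha with ⟨rfl, x, rfl⟩ | ⟨f, rfl⟩
    · exact ⟨.var x :: ts, by simp, by simp [word_var]⟩
    · refine ⟨.func f (fun i => ts[i.1]'(i.2.trans_le hle)) :: ts.drop a, by simp, ?_⟩
      have : (List.ofFn fun i : Fin a => ts[i.1]'(i.2.trans_le hle)) = ts.take a :=
        List.ext_getElem (by simpa using hle) fun i h1 h2 => by simp
      rw [List.flatMap_cons, word_func, this, List.cons_append, ← List.flatMap_append,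
        List.take_append_drop]

/-- The remainder `l` is there for the induction, in which an argument is followed by the later
arguments. -/
theorem parse_word_append {ar : ℕ → Option ℕ} (t : L.Term β)
    (har : ∀ s ∈ word t, ∀ a, IsSymbol L β s a → ar s = some a) (l : List ℕ) :
    parse ar (word t ++ l) = (parse ar l).map (· + 1) := by
  have hcons : ∀ s l, parse ar (s :: l) = (parse ar l).bind fun k => (ar s).bind fun a =>
      if a ≤ k then some (k - a + 1) else none := fun _ _ => rfl
  induction t generalizing l with
  | var x =>
    have := har (2 * encode x) (by simp [word_var]) 0 (.inl ⟨rfl, x, rfl⟩)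
    rw [word_var, List.singleton_append, hcons, this]
    cases parse ar l <;> simp
  | @func n f ts ih =>
    have key : ∀ is : List (Fin n), parse ar ((is.flatMap fun i => word (ts i)) ++ l) =
        (parse ar l).map (· + is.length) := by
      intro is
      induction is with
      | nil => simp
      | cons i is ihs =>
        rw [List.flatMap_cons, List.append_assoc, ih i _ , ihs, Option.map_map]
        · rfl
        · intro s hs
          refine har s ?_
          rw [word_func]
          exact List.mem_cons_of_mem _ (List.mem_flatMap.2 ⟨ts i, by simp, hs⟩)
    have := har (2 * encode (⟨n, f⟩ : Σ n, L.Functions n) + 1) (by simp [word_func]) n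
      (.inr ⟨f, rfl⟩)
    rw [word_func, List.cons_append, hcons, this, List.ofFn_eq_map, List.flatMap_map, key]
    cases parse ar l <;> simp

theorem parse_word {ar : ℕ → Option ℕ} (t : L.Term β)
    (har : ∀ s ∈ word t, ∀ a, IsSymbol L β s a → ar s = some a) :
    parse ar (word t) = some 1 := by
  simpa [parse] using parse_word_append t har []

theorem exists_term_of_parse {ar : ℕ → Option ℕ} (har : ∀ s a, ar s = some a → IsSymbol L β s a)
    {l : List ℕ} (h : parse ar l = some 1) : ∃ t : L.Term β, word t = l := by
  obtain ⟨ts, h1, rfl⟩ := exists_terms_of_parse har h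
  obtain ⟨t, rfl⟩ := List.length_eq_one_iff.1 h1
  exact ⟨t, by simp⟩

theorem exists_isSymbol (t : L.Term β) : ∀ s ∈ word t, ∃ a, IsSymbol L β s a := by
  induction t with
  | var x => exact fun s hs => ⟨0, .inl ⟨rfl, x, by simpa [word_var] using hs⟩⟩
  | func f ts ih =>
    intro s hs
    rw [word_func, List.mem_cons, List.mem_flatMap] at hs
    rcases hs with rfl | ⟨t, ht, hs⟩
    · exact ⟨_, .inr ⟨f, rfl⟩⟩
    · obtain ⟨i, rfl⟩ := List.mem_ofFn.1 ht
      exact ih i s hs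

end Words

/-! ### Codes of the equality axioms -/

section EqualityAxioms

variable {L : FirstOrder.Language.{u, v}} [Encodable (Σ n, L.Functions n)]
  [Encodable (Σ n, L.Relations n)]

/-- The code of an equation between two variables of an axiom. -/
def varEqCode (i j : ℕ) : ℕ := Nat.pair 0 (Nat.pair (encode [2 * i]) (encode [2 * j]))

/-- The code of the list of the equations `xᵢ = yᵢ`, for `i < n`. -/
def varEqCodes (n : ℕ) : List ℕ := (List.range n).map fun i => varEqCode i (n + i)

/-- The code of the axiom with `n` variables, the hypotheses coded by `H` and the conclusion coded
by `K`. -/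
def algebraicCode (n : ℕ) (H : List ℕ) (K : ℕ) : ℕ := encode (n, H, [(0, [K])])

/-- The code of the congruence axiom for the function with the code `e` and the arity `n`. -/
def funcAxiomCode (n e : ℕ) : ℕ :=
  algebraicCode (n + n) (varEqCodes n) (Nat.pair 0 (Nat.pair
    (encode ((2 * e + 1) :: (List.range n).map fun i => 4 * i))
    (encode ((2 * e + 1) :: (List.range n).map fun i => 4 * (n + i)))))

/-- The code of the congruence axiom for the relation with the code `e` and the arity `n`. -/
def relAxiomCode (n e : ℕ) : ℕ :=
  algebraicCode (n + n)
    (Nat.pair 1 (Nat.pair e (encode ((List.range n).map fun i => encode [2 * i]))) :: varEqCodes n)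
    (Nat.pair 1 (Nat.pair e (encode ((List.range n).map fun i => encode [4 * (n + i)]))))

theorem code_algebraic {n : ℕ} (H : List (Atom L (Fin n))) (K : Atom L (Fin n)) :
    (DynAxiom.algebraic H K).code =
      algebraicCode n (H.map Atom.code) (K.relabel (Sum.inl : Fin n → Fin n ⊕ Fin 0)).code := rfl

theorem ofFn_eq_map_range {X : Type*} (n : ℕ) (F : ℕ → X) :
    (List.ofFn fun i : Fin n => F i) = (List.range n).map F :=
  List.ext_getElem (by simp) fun i h1 h2 => by simp

theorem map_code_ofFn_equal (n : ℕ) :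
    (List.ofFn fun i : Fin n => (Atom.equal (.var (Fin.castAdd n i)) (.var (Fin.natAdd n i)) :
      Atom L (Fin (n + n)))).map Atom.code = varEqCodes n := by
  rw [List.map_ofFn, varEqCodes, ← ofFn_eq_map_range]
  rfl

/-- The variables of a conclusion lie in the left summand of `Fin (n + n) ⊕ Fin 0`, which doubles
their codes. Hence the factor `4` in the conclusion, against `2` in the hypotheses. -/
theorem code_funcAxiom {n : ℕ} (f : L.Functions n) :
    (DynAxiom.algebraic (n := n + n)
      (List.ofFn fun i : Fin n => .equal (.var (Fin.castAdd n i)) (.var (Fin.natAdd n i)))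
      (.equal (.func f fun i => .var (Fin.castAdd n i))
        (.func f fun i => .var (Fin.natAdd n i)))).code =
      funcAxiomCode n (encode (⟨n, f⟩ : Σ n, L.Functions n)) := by
  have key : ∀ (g : Fin n → Fin (n + n)) (F : ℕ → ℕ), (∀ i, (g i : ℕ) = F i) →
      encode ((Term.func f fun i => .var (g i)).relabel (Sum.inl : _ → Fin (n + n) ⊕ Fin 0)) =
      encode ((2 * encode (⟨n, f⟩ : Σ n, L.Functions n) + 1) ::
        (List.range n).map fun i => 4 * F i) := by
    intro g F hF
    rw [← encode_word, Term.relabel, word_func, ← ofFn_eq_map_range]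
    congr 2
    rw [List.ofFn_eq_map, List.flatMap_map, List.ofFn_eq_map, List.map_eq_flatMap]
    congr 1
    funext i
    simp only [Term.relabel, word_var, encode_inl, ← hF]
    have : encode (g i) = (g i : ℕ) := rfl
    rw [this]
    congr 1
    ring
  rw [code_algebraic, map_code_ofFn_equal, funcAxiomCode, Atom.relabel, Atom.code,
    key _ (fun i => i) fun _ => rfl, key _ (fun i => n + i) fun _ => rfl]
  rfl

theorem code_relAxiom {n : ℕ} (r : L.Relations n) :
    (DynAxiom.algebraic (n := n + n)
      (.rel r (fun i => .var (Fin.castAdd n i)) ::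
        List.ofFn fun i : Fin n => .equal (.var (Fin.castAdd n i)) (.var (Fin.natAdd n i)))
      (.rel r fun i => .var (Fin.natAdd n i))).code =
      relAxiomCode n (encode (⟨n, r⟩ : Σ n, L.Relations n)) := by
  rw [code_algebraic, List.map_cons, map_code_ofFn_equal, relAxiomCode]
  congr 2
  · simp only [Atom.code, ← encode_word, word_var]
    rw [← ofFn_eq_map_range]
    rfl
  · simp only [Atom.relabel, Term.relabel, Atom.code, ← encode_word, word_var]
    rw [← ofFn_eq_map_range]
    have : ∀ i : Fin n, 2 * encode (Sum.inl (Fin.natAdd n i) : Fin (n + n) ⊕ Fin 0) =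
        4 * (n + i) := fun i => by
      rw [encode_inl, ← mul_assoc]; rfl
    simp only [this]
    rfl

/-- `k` is the code of an equality axiom, where `w = (n, e)` gives the symbol with which the axiom
is concerned, and the tables `F` and `P` give the arities of the function and the relation symbols.
-/
def IsEqAxiomCode (F P : List (Option ℕ)) (k : ℕ) (w : ℕ × ℕ) : Prop :=
  k = algebraicCode 1 [] (varEqCode 0 0) ∨
  k = algebraicCode 2 [varEqCode 0 1] (varEqCode 2 0) ∨
  k = algebraicCode 3 [varEqCode 0 1, varEqCode 1 2] (varEqCode 0 4) ∨
  (F.getD w.2 none = some w.1 ∧ k = funcAxiomCode w.1 w.2) ∨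
  (P.getD w.2 none = some w.1 ∧ k = relAxiomCode w.1 w.2)

theorem code_refl : (DynAxiom.algebraic (L := L) (n := 1) [] (.equal (.var 0) (.var 0))).code =
    algebraicCode 1 [] (varEqCode 0 0) := by
  simp only [code_algebraic, Atom.relabel, Term.relabel, Atom.code, ← encode_word, word_var]
  rfl

theorem code_symm : (DynAxiom.algebraic (L := L) (n := 2) [.equal (.var 0) (.var 1)]
    (.equal (.var 1) (.var 0))).code = algebraicCode 2 [varEqCode 0 1] (varEqCode 2 0) := by
  simp only [code_algebraic, Atom.relabel, Term.relabel, Atom.code, ← encode_word, word_var,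
    List.map_cons, List.map_nil]
  rfl

theorem code_trans : (DynAxiom.algebraic (L := L) (n := 3)
    [.equal (.var 0) (.var 1), .equal (.var 1) (.var 2)] (.equal (.var 0) (.var 2))).code =
      algebraicCode 3 [varEqCode 0 1, varEqCode 1 2] (varEqCode 0 4) := by
  simp only [code_algebraic, Atom.relabel, Term.relabel, Atom.code, ← encode_word, word_var,
    List.map_cons, List.map_nil]
  rfl

/-- The table `T` gives correct arities. -/
def TableSound (X : ℕ → Type*) [Encodable (Σ n, X n)] (T : List (Option ℕ)) : Prop :=
  ∀ e n, T.getD e none = some n → ∃ x : X n, encode (⟨n, x⟩ : Σ n, X n) = e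

theorem IsEqAxiomCode.exists_isEqAxiom {F P : List (Option ℕ)} (hF : TableSound L.Functions F)
    (hP : TableSound L.Relations P) {k : ℕ} {w : ℕ × ℕ} (h : IsEqAxiomCode F P k w) :
    ∃ a : DynAxiom L, IsEqAxiom L a ∧ a.code = k := by
  obtain ⟨n, e⟩ := w
  rcases h with rfl | rfl | rfl | ⟨h, rfl⟩ | ⟨h, rfl⟩
  · exact ⟨_, .refl, code_refl⟩
  · exact ⟨_, .symm, code_symm⟩
  · exact ⟨_, .trans, code_trans⟩
  · obtain ⟨f, rfl⟩ := hF e n h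
    exact ⟨_, .func f, code_funcAxiom f⟩
  · obtain ⟨r, rfl⟩ := hP e n h
    exact ⟨_, .rel r, code_relAxiom r⟩

/-- The tables `T N` give correct arities, and each symbol appears in all but finitely many of
them. -/
structure Tables (X : ℕ → Type*) [Encodable (Σ n, X n)] (T : ℕ → List (Option ℕ)) : Prop where
  sound : ∀ N, TableSound X (T N)
  complete : ∀ n (x : X n), ∀ᶠ N in Filter.atTop,
    (T N).getD (encode (⟨n, x⟩ : Σ n, X n)) none = some n

/-- The witness is chosen before `N`, so that one instruction works for all large tables. -/
theorem eventually_isEqAxiomCode {F P : ℕ → List (Option ℕ)} (hF : Tables L.Functions F)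
    (hP : Tables L.Relations P) {a : DynAxiom L} (ha : IsEqAxiom L a) :
    ∃ w, ∀ᶠ N in Filter.atTop, IsEqAxiomCode (F N) (P N) a.code w := by
  cases ha with
  | refl => exact ⟨(0, 0), .of_forall fun N => .inl code_refl⟩
  | symm => exact ⟨(0, 0), .of_forall fun N => .inr (.inl code_symm)⟩
  | trans => exact ⟨(0, 0), .of_forall fun N => .inr (.inr (.inl code_trans))⟩
  | @func n f =>
    exact ⟨(n, encode (⟨n, f⟩ : Σ n, L.Functions n)), (hF.complete n f).mono fun N h =>
      .inr (.inr (.inr (.inl ⟨h, code_funcAxiom f⟩)))⟩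
  | @rel n r =>
    exact ⟨(n, encode (⟨n, r⟩ : Σ n, L.Relations n)), (hP.complete n r).mono fun N h =>
      .inr (.inr (.inr (.inr ⟨h, code_relAxiom r⟩)))⟩

end EqualityAxioms

/-! ### A checker that builds coverings from the leaves upwards -/

section Checker

/-- A judgment `(m, s, c)` says that `c` is the code of a covering that proves the goal, for each
set of relations on `α ⊕ Fin m` that contains the atomic formulas coded by the members of `s`. -/
abbrev Judgment := ℕ × List ℕ × ℕ

/-- The tables of the arities of the function and of the relation symbols, the codes of the axioms
and the code of the goal. -/
abbrev Env := List (Option ℕ) × List (Option ℕ) × List ℕ × ℕ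

/-- An instruction `((m, s, k), σ, cs, w)` to apply the axiom with the code `k` to the terms `σ`,
when the coverings with the codes `cs` have been found for the children; `w` is the witness that `k`
codes an equality axiom. -/
abbrev Instruction := (ℕ × List ℕ × ℕ) × List ℕ × List ℕ × ℕ × ℕ

/-- The arity of the symbol with the code `s` in terms over `α ⊕ Fin m`. -/
def symbolArity (α : Type w) [Encodable α] (F : List (Option ℕ)) (m s : ℕ) : Option ℕ :=
  if s % 2 = 0 then
    if s / 2 % 2 = 0 then (decode₂ α (s / 2 / 2)).map fun _ => 0
    else if s / 2 / 2 < m then some 0 else none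
  else F.getD (s / 2) none

/-- The substitution of the terms coded by `σ` for the variables of the hypothesis of an axiom. -/
def hypSubst (σ : List ℕ) (v : ℕ) : List ℕ := numList (σ.getD v 0)

/-- The substitution of the terms coded by `σ`, and of the new generators from the `m`-th one on,
for the variables of a disjunct of an axiom. -/
def conclSubst (m : ℕ) (σ : List ℕ) (v : ℕ) : List ℕ :=
  if v % 2 = 0 then numList (σ.getD (v / 2) 0) else [2 * (2 * (m + v / 2) + 1)]

/-- The codes of the relations of a child. -/
def childCodes (m : ℕ) (s σ : List ℕ) (d : ℕ × List ℕ) : List ℕ :=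
  s ++ d.2.map (substAtomCode (conclSubst m σ))

/-- The axiom with the code `k`. -/
def axiomData (k : ℕ) : ℕ × List ℕ × List (ℕ × List ℕ) := (decode k).getD (0, [], [])

/-- The code `c` is that of a term over `α ⊕ Fin m`. -/
def IsTermCode (α : Type w) [Encodable α] (F : List (Option ℕ)) (m c : ℕ) : Prop :=
  parse (symbolArity α F m) (numList c) = some 1 ∧ encode (numList c) = c

/-- The instruction `i` can be carried out when the judgments `st` have been established. -/
def Applies (α : Type w) [Encodable α] (e : Env) (i : Instruction) (st : List Judgment) : Prop :=
  (i.1.2.2 ∈ e.2.2.1 ∨ IsEqAxiomCode e.1 e.2.1 i.1.2.2 i.2.2.2) ∧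
  i.2.1.length = (axiomData i.1.2.2).1 ∧
  (∀ c ∈ i.2.1, IsTermCode α e.1 i.1.1 c) ∧
  (∀ h ∈ (axiomData i.1.2.2).2.1, substAtomCode (hypSubst i.2.1) h ∈ i.1.2.1) ∧
  i.2.2.1.length = (axiomData i.1.2.2).2.2.length ∧
  ∀ j < (axiomData i.1.2.2).2.2.length,
    (i.1.1 + ((axiomData i.1.2.2).2.2.getD j (0, [])).1,
      childCodes i.1.1 i.1.2.1 i.2.1 ((axiomData i.1.2.2).2.2.getD j (0, [])),
      i.2.2.1.getD j 0) ∈ st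

/-- The code of the covering that applies an axiom and continues with the coverings `cs`. -/
def branchCode (k : ℕ) (σ cs : List ℕ) : ℕ := encode (2, k, σ, cs)

open Classical in
/-- Adds to the judgments `st` those that the instruction `i` establishes. -/
noncomputable def step (α : Type w) [Encodable α] (e : Env) (i : Instruction)
    (st : List Judgment) : List Judgment :=
  (if e.2.2.2 ∈ i.1.2.1 then [(i.1.1, i.1.2.1, encode (0, 0))] else []) ++
    ((if Applies α e i st then [(i.1.1, i.1.2.1, branchCode i.1.2.2 i.2.1 i.2.2.1)] else []) ++ st)

/-- The judgments that the instructions `l`, the last one being carried out first, establish. -/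
noncomputable def run (α : Type w) [Encodable α] (e : Env) (l : List Instruction) :
    List Judgment := l.foldr (step α e) []

variable {α : Type w} [Encodable α] {e : Env}

/-- Established judgments are only ever required, never excluded. This is why lists of instructions
for several children can be concatenated. -/
theorem step_subset_step {i : Instruction} {st st' : List Judgment} (h : st ⊆ st') :
    step α e i st ⊆ step α e i st' := by
  have : Applies α e i st → Applies α e i st' := fun ⟨h1, h2, h3, h4, h5, h6⟩ =>
    ⟨h1, h2, h3, h4, h5, fun j hj => h (h6 j hj)⟩
  intro x hx
  simp only [step, List.mem_append, List.mem_ite_nil_right] at hx ⊢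
  exact hx.imp_right (Or.imp (And.imp_left this) fun hx => h hx)

theorem subset_step (i : Instruction) (st : List Judgment) : st ⊆ step α e i st :=
  fun _ h => List.mem_append_right _ (List.mem_append_right _ h)

theorem run_subset_append_right (l l' : List Instruction) : run α e l' ⊆ run α e (l ++ l') := by
  induction l with
  | nil => exact List.Subset.refl _
  | cons i l ih => exact List.Subset.trans ih (subset_step i _)

theorem run_subset_append_left (l l' : List Instruction) : run α e l ⊆ run α e (l ++ l') := by
  induction l with
  | nil => exact List.nil_subset _
  | cons i l ih => exact step_subset_step ih

theorem run_subset_flatten {ls : List (List Instruction)} {l : List Instruction} (h : l ∈ ls) :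
    run α e l ⊆ run α e ls.flatten := by
  obtain ⟨l₁, l₂, rfl⟩ := List.append_of_mem h
  rw [List.flatten_append, List.flatten_cons]
  exact List.Subset.trans (run_subset_append_left _ _) (run_subset_append_right _ _)

end Checker

/-! ### Soundness and completeness of the checker -/

section Correctness

variable {L : FirstOrder.Language.{u, v}} [Encodable (Σ n, L.Functions n)] {α : Type w}
  [Encodable α]

theorem isSymbol_of_symbolArity {F : List (Option ℕ)} (hF : TableSound L.Functions F)
    {m s a : ℕ} (h : symbolArity α F m s = some a) : IsSymbol L (α ⊕ Fin m) s a := by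
  unfold symbolArity at h
  split_ifs at h with h1 h2 h3
  · obtain ⟨x, hx, rfl⟩ := Option.map_eq_some_iff.1 h
    refine .inl ⟨rfl, .inl x, ?_⟩
    rw [encode_inl, decode₂_eq_some.1 hx]
    lia
  · obtain rfl : 0 = a := by simpa using h
    refine .inl ⟨rfl, .inr ⟨_, h3⟩, ?_⟩
    have : encode (⟨s / 2 / 2, h3⟩ : Fin m) = s / 2 / 2 := rfl
    rw [encode_inr, this]
    lia
  · obtain ⟨f, hf⟩ := hF _ _ h
    refine .inr ⟨f, ?_⟩
    rw [hf]
    lia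

theorem eventually_symbolArity {F : ℕ → List (Option ℕ)} (hF : Tables L.Functions F)
    {m s a : ℕ} (h : IsSymbol L (α ⊕ Fin m) s a) :
    ∀ᶠ N in Filter.atTop, symbolArity α (F N) m s = some a := by
  rcases h with ⟨rfl, x | x, rfl⟩ | ⟨f, rfl⟩
  · refine .of_forall fun N => ?_
    simp [symbolArity]
  · refine .of_forall fun N => ?_
    have : encode x = (x : ℕ) := rfl
    have h2 : (2 * (x : ℕ) + 1) / 2 = x := by lia
    simp [symbolArity, this, Nat.add_mod, h2]
  · filter_upwards [hF.complete _ f] with N hN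
    have h2 : ∀ k : ℕ, (2 * k + 1) / 2 = k := by lia
    simpa [symbolArity, Nat.add_mod, h2] using hN

theorem eventually_parse_word {F : ℕ → List (Option ℕ)} (hF : Tables L.Functions F) {m : ℕ}
    (t : L.Term (α ⊕ Fin m)) :
    ∀ᶠ N in Filter.atTop, parse (symbolArity α (F N) m) (word t) = some 1 := by
  have : ∀ s ∈ word t, ∀ᶠ N in Filter.atTop,
      ∀ a, IsSymbol L (α ⊕ Fin m) s a → symbolArity α (F N) m s = some a := fun s hs => by
    obtain ⟨a₀, ha₀⟩ := exists_isSymbol t s hs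
    filter_upwards [eventually_symbolArity hF ha₀] with N hN a ha
    -- A symbol has only one arity, as two arities would be values of the same table.
    obtain ⟨N', h1, h2⟩ := ((eventually_symbolArity hF ha).and
      (eventually_symbolArity hF ha₀)).exists
    rw [hN, ← h2, h1]
  have := (Filter.eventually_all_finite (List.finite_toSet (word t))).2 this
  filter_upwards [this] with N hN
  exact parse_word t hN

theorem encode_relabel {β γ : Type*} [Encodable β] [Encodable γ] {g : β → γ}
    (h : ∀ x, encode (g x) = encode x) (t : L.Term β) : encode (t.relabel g) = encode t := by
  rw [← encode_word, ← encode_word]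
  congr 1
  induction t with
  | var x => rw [Term.relabel, word_var, word_var, h]
  | func f ts ih =>
    rw [Term.relabel, word_func, word_func, List.ofFn_eq_map, List.flatMap_map, List.ofFn_eq_map,
      List.flatMap_map]
    simp only [ih]

/-- The code of a generator does not depend on how many generators there are, so a child can keep
the codes of its parent's relations unchanged. -/
theorem encode_sumMap_castAdd (m k : ℕ) (x : α ⊕ Fin m) :
    encode (Sum.map id (Fin.castAdd k) x : α ⊕ Fin (m + k)) = encode x := by
  rcases x with x | x <;> rfl

theorem encode_sumMap_val (m : ℕ) (x : α ⊕ Fin m) :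
    encode (Sum.map id Fin.val x : α ⊕ ℕ) = encode x := by
  rcases x with x | x <;> rfl

theorem hypSubst_encode {n : ℕ} {β : Type*} [Encodable β] (σ : Fin n → L.Term β) (x : Fin n) :
    hypSubst (List.ofFn fun j => encode (σ j)) (encode x) = word (σ x) := by
  have : encode x = (x : ℕ) := rfl
  simp [hypSubst, this]

theorem conclSubst_encode {n k m : ℕ} {β : Type*} [Encodable β] (σ : Fin n → L.Term β)
    {τ : Fin n ⊕ Fin k → L.Term β} (h1 : ∀ j, word (τ (.inl j)) = word (σ j))
    (h2 : ∀ z : Fin k, word (τ (.inr z)) = [2 * (2 * (m + z) + 1)]) (x : Fin n ⊕ Fin k) :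
    conclSubst m (List.ofFn fun j => encode (σ j)) (encode x) = word (τ x) := by
  rcases x with x | x
  · have : encode x = (x : ℕ) := rfl
    simp [conclSubst, this, h1]
  · have : encode x = (x : ℕ) := rfl
    have h : (2 * (x : ℕ) + 1) / 2 = x := by lia
    simp [conclSubst, this, h2, h, Nat.add_mod]

variable [Encodable (Σ n, L.Relations n)]

theorem Atom.code_relabel {β γ : Type*} [Encodable β] [Encodable γ] {g : β → γ}
    (h : ∀ x, encode (g x) = encode x) (A : Atom L β) : (A.relabel g).code = A.code := by
  cases A <;> simp only [Atom.relabel, Atom.code, encode_relabel h]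

theorem axiomData_code (a : DynAxiom L) :
    axiomData a.code =
      (a.n, a.hyp.map Atom.code, a.concl.map fun d => (d.arity, d.atoms.map Atom.code)) := by
  simp [axiomData, DynAxiom.code]

variable {D : DynTheory L} {B : Atom L α}

/-- The judgment `j` is true, for the theory `D` and the goal `B`. -/
def JudgmentTrue (D : DynTheory L) (B : Atom L α) (j : Judgment) : Prop :=
  ∀ S : Set (Atom L (α ⊕ Fin j.1)), (∀ x ∈ j.2.1, ∃ A ∈ S, A.code = x) →
    ∃ τ : Covering D j.1 S, τ.Proves B ∧ τ.code = j.2.2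

theorem mem_of_code_mem {β : Type*} [Encodable β] {S : Set (Atom L β)} {s : List ℕ}
    (h : ∀ x ∈ s, ∃ A ∈ S, A.code = x) {A : Atom L β} (hA : A.code ∈ s) : A ∈ S := by
  obtain ⟨A', hA', hc⟩ := h _ hA
  rwa [← Atom.code_injective hc]

/-- The environment `e` is that of a theory included in `D` and of the goal `B`. -/
structure Env.Sound (D : DynTheory L) (B : Atom L α) (e : Env) : Prop where
  funcs : TableSound L.Functions e.1
  rels : TableSound L.Relations e.2.1
  axs : ∀ k ∈ e.2.2.1, ∃ a ∈ D, a.code = k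
  goal : e.2.2.2 = (B.relabel Sum.inl : Atom L (α ⊕ ℕ)).code

/-- Each check decodes one argument of `Covering.branch`: the axiom, the terms (by `parse`), the
hypotheses, and the coverings of the children from judgments already known to be true. -/
theorem judgmentTrue_of_applies {e : Env} (he : e.Sound D B) {i : Instruction}
    {st : List Judgment} (hst : ∀ j ∈ st, JudgmentTrue D B j) (h : Applies α e i st) :
    JudgmentTrue D B (i.1.1, i.1.2.1, branchCode i.1.2.2 i.2.1 i.2.2.1) := by
  obtain ⟨⟨m, s, k⟩, σ, cs, w⟩ := i
  obtain ⟨hk, hσ, hterm, hhyp, hlen, hch⟩ := h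
  dsimp only at hk hσ hterm hhyp hlen hch ⊢
  obtain ⟨a, ha, rfl⟩ : ∃ a ∈ D.withEq, a.code = k := by
    rcases hk with hk | hk
    · obtain ⟨a, ha, h⟩ := he.axs k hk
      exact ⟨a, .inl ha, h⟩
    · obtain ⟨a, ha, h⟩ := hk.exists_isEqAxiom he.funcs he.rels
      exact ⟨a, .inr ha, h⟩
  rw [axiomData_code] at hσ hhyp hlen hch
  simp only [List.length_map] at hσ hlen hch
  obtain ⟨σ, rfl⟩ : ∃ σ' : Fin a.n → L.Term (α ⊕ Fin m),
      List.ofFn (fun j => encode (σ' j)) = σ := by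
    have : ∀ j : Fin a.n, ∃ t : L.Term (α ⊕ Fin m), encode t = σ[j.1]'(j.2.trans_eq hσ.symm) :=
      fun j => by
        obtain ⟨h1, h2⟩ := hterm _ (List.getElem_mem (j.2.trans_eq hσ.symm))
        obtain ⟨t, ht⟩ := exists_term_of_parse (fun s a => isSymbol_of_symbolArity he.funcs) h1
        exact ⟨t, by rw [← encode_word, ht, h2]⟩
    choose σ' hσ' using this
    exact ⟨σ', List.ext_getElem (by simp [hσ]) fun i h1 h2 => by simp [hσ']⟩
  intro S hS
  dsimp only at S hS ⊢
  have hyp : ∀ A ∈ a.hyp, A.subst σ ∈ S := fun A hA => by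
    have := hhyp _ (List.mem_map_of_mem hA)
    rw [substAtomCode_code (hypSubst_encode σ)] at this
    exact mem_of_code_mem hS this
  have hchild : ∀ j : Fin a.concl.length, ∃ τ : Covering D (m + (a.concl.get j).arity)
      (extend S σ (a.concl.get j)), τ.Proves B ∧ τ.code = cs[j.1]'(j.2.trans_eq hlen.symm) := by
    intro j
    have hj := hst _ (hch j j.2)
    simp only [List.getD_eq_getElem?_getD, List.getElem?_map, List.getElem?_eq_getElem j.2,
      List.getElem?_eq_getElem (j.2.trans_eq hlen.symm), Option.map_some, Option.getD_some] at hj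
    refine hj (extend S σ (a.concl.get j)) fun x hx => ?_
    rcases List.mem_append.1 hx with hx | hx
    · obtain ⟨A, hA, rfl⟩ := hS x hx
      exact ⟨_, .inl ⟨A, hA, rfl⟩, A.code_relabel (encode_sumMap_castAdd m _)⟩
    · simp only [List.map_map, List.mem_map] at hx
      obtain ⟨A, hA, rfl⟩ := hx
      refine ⟨_, .inr (List.mem_map_of_mem hA), ?_⟩
      rw [Function.comp_apply, ← substAtomCode_code (g := conclSubst m _)]
      -- The terms of `σ` keep their codes when read over the generators of the child.
      have hw : ∀ t : L.Term (α ⊕ Fin m),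
          encode (t.relabel (Sum.map id (Fin.castAdd (a.concl.get j).arity))) = encode t :=
        encode_relabel (encode_sumMap_castAdd m _)
      have := conclSubst_encode (m := m) (fun i => (σ i).relabel
        (Sum.map id (Fin.castAdd (a.concl.get j).arity))) (τ := Sum.elim (fun j => _)
          fun z : Fin (a.concl.get j).arity => .var (.inr (Fin.natAdd m z)))
          (fun _ => rfl) fun z => rfl
      simpa only [hw] using this
  choose τ hτ1 hτ2 using hchild
  refine ⟨.branch a ha σ hyp τ, hτ1, ?_⟩
  rw [Covering.code, branchCode]
  congr 4
  exact List.ext_getElem (by simp [hlen]) fun i h1 h2 => by simp [hτ2]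

theorem judgmentTrue_of_mem_run {e : Env} (he : e.Sound D B) {l : List Instruction} :
    ∀ j ∈ run α e l, JudgmentTrue D B j := by
  induction l with
  | nil => exact fun j hj => absurd hj List.not_mem_nil
  | cons i l ih =>
    intro j hj
    simp only [run, List.foldr_cons, step, List.mem_append, List.mem_ite_nil_right,
      List.mem_singleton] at hj
    rcases hj with ⟨h, rfl⟩ | ⟨h, rfl⟩ | h
    · refine fun S hS => ⟨.leaf, mem_of_code_mem hS ?_, rfl⟩
      rw [he.goal] at h
      rw [← Atom.code_relabel (encode_sumMap_val _)]
      convert h using 2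
      simp only [Atom.relabel_eq_subst, Atom.subst_subst]
      rfl
    · exact judgmentTrue_of_applies he ih h
    · exact ih j h

/-- A proof of provability is finite, so it involves finitely many symbols, and all tables from some
point on contain them. The list of instructions and the code are fixed before the table. -/
theorem Provable.exists_instructions {e : ℕ → Env}
    (hF : Tables L.Functions fun N => (e N).1) (hP : Tables L.Relations fun N => (e N).2.1)
    (haxs : ∀ N, ∀ a ∈ D, a.code ∈ (e N).2.2.1)
    (hgoal : ∀ N, (e N).2.2.2 = (B.relabel Sum.inl : Atom L (α ⊕ ℕ)).code) {p : Node L α}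
    (h : Provable D B p) {s : List ℕ} (hs : ∀ A ∈ p.2, A.code ∈ s) :
    ∃ (l : List Instruction) (c : ℕ), ∀ᶠ N in Filter.atTop, (p.1, s, c) ∈ run α (e N) l := by
  induction h generalizing s with
  | @leaf p h =>
    -- The leaf clause of `step` looks only at `p.1` and `s`; the other entries are dummies.
    refine ⟨[((p.1, s, 0), [], [], 0, 0)], encode (0, 0), .of_forall fun N => ?_⟩
    refine List.mem_append_left _ ?_
    rw [if_pos]
    · exact List.mem_singleton.2 rfl
    · rw [hgoal]
      exact hs _ h
  | @branch p a mem σ bdd hyp children ih =>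
    have hcode : ∀ (i : Fin a.concl.length), ∀ A ∈ (p.child σ (a.concl.get i)).2,
        A.code ∈ childCodes p.1 s (List.ofFn fun j => encode (σ j))
          ((a.concl.get i).arity, (a.concl.get i).atoms.map Atom.code) := by
      rintro i A (hA | hA)
      · exact List.mem_append_left _ (hs A hA)
      · obtain ⟨A, hA', rfl⟩ := List.mem_map.1 hA
        refine List.mem_append_right _ (List.mem_map.2 ⟨_, List.mem_map_of_mem hA', ?_⟩)
        exact substAtomCode_code (conclSubst_encode σ (fun _ => rfl) fun z => rfl) A
    choose l c hlc using fun i : Fin a.concl.length =>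
      ih (a.concl.get i) (List.get_mem _ _) (hcode i)
    obtain ⟨w, hw⟩ : ∃ w, ∀ᶠ N in Filter.atTop, a.code ∈ (e N).2.2.1 ∨
        IsEqAxiomCode (e N).1 (e N).2.1 a.code w := by
      rcases mem with mem | mem
      · exact ⟨(0, 0), .of_forall fun N => .inl (haxs N a mem)⟩
      · obtain ⟨w, hw⟩ := eventually_isEqAxiomCode hF hP mem
        exact ⟨w, hw.mono fun _ => .inr⟩
    have hterm : ∀ᶠ N in Filter.atTop, ∀ j, IsTermCode α (e N).1 p.1 (encode (σ j)) := by
      refine Filter.eventually_all.2 fun j => ?_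
      obtain ⟨t, ht⟩ := bdd j
      filter_upwards [eventually_parse_word hF t] with N hN
      rw [← ht, encode_relabel (encode_sumMap_val _), IsTermCode, numList_encode_term, encode_word]
      exact ⟨hN, rfl⟩
    -- The last instruction is carried out first, so those of the children stand behind the one that
    -- joins them.
    refine ⟨((p.1, s, a.code), List.ofFn fun j => encode (σ j), List.ofFn c, w) ::
      (List.ofFn l).flatten, branchCode a.code (List.ofFn fun j => encode (σ j)) (List.ofFn c), ?_⟩
    filter_upwards [hw, hterm, Filter.eventually_all.2 hlc] with N hw hterm hlc
    refine List.mem_append_right _ (List.mem_append_left _ ?_)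
    rw [if_pos]
    · exact List.mem_singleton.2 rfl
    · refine ⟨hw, ?_⟩
      dsimp only
      rw [axiomData_code]
      refine ⟨by simp, by simpa [List.mem_ofFn] using hterm, fun h hh => ?_, by simp,
        fun j hj => ?_⟩
      · obtain ⟨A, hA, rfl⟩ := List.mem_map.1 hh
        rw [substAtomCode_code (hypSubst_encode σ)]
        exact hs _ (hyp A hA)
      · have hj' : j < a.concl.length := by simpa using hj
        have := run_subset_flatten (List.mem_ofFn.2 ⟨⟨j, hj'⟩, rfl⟩) (hlc ⟨j, hj'⟩)
        simpa [hj', run, Node.child] using this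

end Correctness

/-! ### Primitive recursiveness of the checker -/

section Primrec

open Primrec

variable {X : Type*} [Primcodable X]

theorem primrec_numList : Primrec numList := option_getD.comp Primrec.decode (const [])

theorem primrec_substWord {g : X → ℕ → List ℕ} (hg : Primrec₂ g) {l : X → List ℕ}
    (hl : Primrec l) : Primrec fun x => substWord (g x) (l x) :=
  list_flatMap hl (Primrec.ite (Primrec.eq.comp (nat_mod.comp snd (const 2)) (const 0))
    (hg.comp fst (nat_div.comp snd (const 2))) (list_cons.comp snd (const [])))

theorem primrec_substTermCode {g : X → ℕ → List ℕ} (hg : Primrec₂ g) {c : X → ℕ}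
    (hc : Primrec c) : Primrec fun x => substTermCode (g x) (c x) :=
  Primrec.encode.comp (primrec_substWord hg (primrec_numList.comp hc))

theorem primrec_substAtomCode {g : X → ℕ → List ℕ} (hg : Primrec₂ g) {c : X → ℕ}
    (hc : Primrec c) : Primrec fun x => substAtomCode (g x) (c x) := by
  have h2 : Primrec fun x => (c x).unpair.2.unpair := unpair.comp (snd.comp (unpair.comp hc))
  refine Primrec.ite (Primrec.eq.comp (fst.comp (unpair.comp hc)) (const 0))
    (Primrec₂.natPair.comp (const 0) (Primrec₂.natPair.comp
      (primrec_substTermCode hg (fst.comp h2)) (primrec_substTermCode hg (snd.comp h2))))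
    (Primrec₂.natPair.comp (const 1) (Primrec₂.natPair.comp (fst.comp h2)
      (Primrec.encode.comp (list_map (primrec_numList.comp (snd.comp h2)) ?_))))
  exact primrec_substTermCode (g := fun p : X × ℕ => g p.1) (hg.comp (fst.comp fst) snd) snd

theorem primrec_singleton {f : X → ℕ} (hf : Primrec f) : Primrec fun x => [f x] :=
  list_cons.comp hf (const [])

theorem primrec_varEqCode : Primrec₂ varEqCode :=
  Primrec₂.natPair.comp (const 0) (Primrec₂.natPair.comp
    (Primrec.encode.comp (primrec_singleton (nat_mul.comp (const 2) fst)))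
    (Primrec.encode.comp (primrec_singleton (nat_mul.comp (const 2) snd))))

theorem primrec_varEqCodes : Primrec varEqCodes :=
  list_map list_range (primrec_varEqCode.comp snd (nat_add.comp fst snd))

theorem primrec_algebraicCode {n : X → ℕ} {H : X → List ℕ} {K : X → ℕ} (hn : Primrec n)
    (hH : Primrec H) (hK : Primrec K) : Primrec fun x => algebraicCode (n x) (H x) (K x) :=
  Primrec.encode.comp (hn.pair (hH.pair
    (list_cons.comp ((const 0).pair (primrec_singleton hK)) (const []))))

theorem primrec_funcAxiomCode : Primrec₂ funcAxiomCode := by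
  have hs : Primrec fun p : ℕ × ℕ => 2 * p.2 + 1 :=
    nat_add.comp (nat_mul.comp (const 2) snd) (const 1)
  exact primrec_algebraicCode (nat_add.comp fst fst) (primrec_varEqCodes.comp fst)
    (Primrec₂.natPair.comp (const 0) (Primrec₂.natPair.comp
      (Primrec.encode.comp (list_cons.comp hs (list_map (list_range.comp fst)
        (nat_mul.comp (const 4) snd))))
      (Primrec.encode.comp (list_cons.comp hs (list_map (list_range.comp fst)
        (nat_mul.comp (const 4) (nat_add.comp (fst.comp fst) snd)))))))

theorem primrec_relAxiomCode : Primrec₂ relAxiomCode :=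
  primrec_algebraicCode (nat_add.comp fst fst)
    (list_cons.comp (Primrec₂.natPair.comp (const 1) (Primrec₂.natPair.comp snd
      (Primrec.encode.comp (list_map (list_range.comp fst)
        (Primrec.encode.comp (primrec_singleton (nat_mul.comp (const 2) snd)))))))
      (primrec_varEqCodes.comp fst))
    (Primrec₂.natPair.comp (const 1) (Primrec₂.natPair.comp snd
      (Primrec.encode.comp (list_map (list_range.comp fst) (Primrec.encode.comp (primrec_singleton
        (nat_mul.comp (const 4) (nat_add.comp (fst.comp fst) snd))))))))

theorem primrecPred_isEqAxiomCode {F P : X → List (Option ℕ)} {k : X → ℕ} {w : X → ℕ × ℕ}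
    (hF : Primrec F) (hP : Primrec P) (hk : Primrec k) (hw : Primrec w) :
    PrimrecPred fun x => IsEqAxiomCode (F x) (P x) (k x) (w x) := by
  have hsome : Primrec fun x => some (w x).1 := option_some.comp (fst.comp hw)
  exact (Primrec.eq.comp hk (const _)).or ((Primrec.eq.comp hk (const _)).or
    ((Primrec.eq.comp hk (const _)).or
    (((Primrec.eq.comp ((list_getD none).comp hF (snd.comp hw)) hsome).and
      (Primrec.eq.comp hk (primrec_funcAxiomCode.comp (fst.comp hw) (snd.comp hw)))).or
    ((Primrec.eq.comp ((list_getD none).comp hP (snd.comp hw)) hsome).and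
      (Primrec.eq.comp hk (primrec_relAxiomCode.comp (fst.comp hw) (snd.comp hw)))))))

theorem primrec_parse {ar : X → ℕ → Option ℕ} (har : Primrec₂ ar) {l : X → List ℕ}
    (hl : Primrec l) : Primrec fun x => parse (ar x) (l x) := by
  refine list_foldr (h := fun x (p : ℕ × Option ℕ) => p.2.bind fun k => (ar x p.1).bind fun a =>
    if a ≤ k then some (k - a + 1) else none) hl (const (some 0)) ?_
  refine option_bind (snd.comp snd) (option_bind
    (har.comp (fst.comp fst) (fst.comp (snd.comp fst))) ?_)
  exact Primrec.ite (nat_le.comp snd (snd.comp fst))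
    (option_some.comp (nat_add.comp (nat_sub.comp (snd.comp fst) snd) (const 1))) (const none)

section Checker

variable {α : Type w} [Primcodable α]

/-- The arities are only assumed computable. Passing them in a finite table `F` keeps the checker
primitive recursive. -/
theorem primrec_symbolArity {F : X → List (Option ℕ)} {m s : X → ℕ} (hF : Primrec F)
    (hm : Primrec m) (hs : Primrec s) : Primrec fun x => symbolArity α (F x) (m x) (s x) := by
  have h2 : Primrec fun x => s x / 2 := nat_div.comp hs (const 2)
  have h4 : Primrec fun x => s x / 2 / 2 := nat_div.comp h2 (const 2)
  exact Primrec.ite (Primrec.eq.comp (nat_mod.comp hs (const 2)) (const 0))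
    (Primrec.ite (Primrec.eq.comp (nat_mod.comp h2 (const 2)) (const 0))
      (option_map (Primrec.decode₂.comp h4) (const 0).to₂)
      (Primrec.ite (nat_lt.comp h4 hm) (const (some 0)) (const none)))
    ((list_getD none).comp hF h2)

theorem primrecPred_isTermCode {F : X → List (Option ℕ)} {m c : X → ℕ} (hF : Primrec F)
    (hm : Primrec m) (hc : Primrec c) : PrimrecPred fun x => IsTermCode α (F x) (m x) (c x) := by
  have h := primrec_numList.comp hc
  refine (Primrec.eq.comp (primrec_parse ?_ h) (const (some 1))).and
    (Primrec.eq.comp (Primrec.encode.comp h) hc)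
  exact primrec_symbolArity (hF.comp fst) (hm.comp fst) snd

theorem primrec_hypSubst : Primrec₂ hypSubst :=
  primrec_numList.comp ((list_getD 0).comp fst snd)

theorem primrec_conclSubst {m : X → ℕ} {σ : X → List ℕ} (hm : Primrec m) (hσ : Primrec σ) :
    Primrec₂ fun x => conclSubst (m x) (σ x) := by
  have h2 : Primrec fun p : X × ℕ => p.2 / 2 := nat_div.comp snd (const 2)
  exact Primrec.ite (Primrec.eq.comp (nat_mod.comp snd (const 2)) (const 0))
    (primrec_numList.comp ((list_getD 0).comp (hσ.comp fst) h2))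
    (primrec_singleton (nat_mul.comp (const 2) (nat_add.comp
      (nat_mul.comp (const 2) (nat_add.comp (hm.comp fst) h2)) (const 1))))

theorem primrec_childCodes {m : X → ℕ} {s σ : X → List ℕ} {d : X → ℕ × List ℕ} (hm : Primrec m)
    (hs : Primrec s) (hσ : Primrec σ) (hd : Primrec d) :
    Primrec fun x => childCodes (m x) (s x) (σ x) (d x) :=
  list_append.comp hs (list_map (snd.comp hd) (primrec_substAtomCode
    (g := fun p : X × ℕ => conclSubst (m p.1) (σ p.1))
    (primrec_conclSubst (hm.comp fst) (hσ.comp fst)) snd))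

theorem primrec_axiomData : Primrec axiomData :=
  option_getD.comp Primrec.decode (const _)

theorem primrecPred_mem {Y : Type*} [Primcodable Y] {y : X → Y} {l : X → List Y}
    (hy : Primrec y) (hl : Primrec l) : PrimrecPred fun x => y x ∈ l x :=
  ((PrimrecRel.exists_mem_list (R := fun a b : Y => a = b) Primrec.eq).comp hl hy).of_eq
    fun x => by simp

theorem primrecPred_forall_mem {Y : Type*} [Primcodable Y] {p : X → Y → Prop} {l : X → List Y}
    (hl : Primrec l) (hp : PrimrecRel p) : PrimrecPred fun x => ∀ y ∈ l x, p x y :=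
  hp.swap.forall_mem_list.comp hl Primrec.id

theorem primrecPred_forall_lt {p : X → ℕ → Prop} {n : X → ℕ}
    (hn : Primrec n) (hp : PrimrecRel p) : PrimrecPred fun x => ∀ j < n x, p x j :=
  (primrecPred_forall_mem (list_range.comp hn) hp).of_eq fun x => by simp

variable (α) in
theorem primrecPred_applies : PrimrecPred fun p : Env × Instruction × List Judgment =>
    Applies α p.1 p.2.1 p.2.2 := by
  have hF : Primrec fun p : Env × Instruction × List Judgment => p.1.1 := fst.comp fst
  have hP : Primrec fun p : Env × Instruction × List Judgment => p.1.2.1 :=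
    fst.comp (snd.comp fst)
  have haxs : Primrec fun p : Env × Instruction × List Judgment => p.1.2.2.1 :=
    fst.comp (snd.comp (snd.comp fst))
  have hi : Primrec fun p : Env × Instruction × List Judgment => p.2.1 := fst.comp snd
  have hst : Primrec fun p : Env × Instruction × List Judgment => p.2.2 := snd.comp snd
  have hm : Primrec fun p : Env × Instruction × List Judgment => p.2.1.1.1 := fst.comp (fst.comp hi)
  have hs : Primrec fun p : Env × Instruction × List Judgment => p.2.1.1.2.1 :=
    fst.comp (snd.comp (fst.comp hi))
  have hk : Primrec fun p : Env × Instruction × List Judgment => p.2.1.1.2.2 :=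
    snd.comp (snd.comp (fst.comp hi))
  have hσ : Primrec fun p : Env × Instruction × List Judgment => p.2.1.2.1 := fst.comp (snd.comp hi)
  have hcs : Primrec fun p : Env × Instruction × List Judgment => p.2.1.2.2.1 :=
    fst.comp (snd.comp (snd.comp hi))
  have hw : Primrec fun p : Env × Instruction × List Judgment => p.2.1.2.2.2 :=
    snd.comp (snd.comp (snd.comp hi))
  have ha := primrec_axiomData.comp hk
  have hd : Primrec fun q : (Env × Instruction × List Judgment) × ℕ =>
      (axiomData q.1.2.1.1.2.2).2.2.getD q.2 (0, []) :=
    (list_getD _).comp (snd.comp (snd.comp (ha.comp fst))) snd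
  refine ((primrecPred_mem hk haxs).or (primrecPred_isEqAxiomCode hF hP hk hw)).and
    ((Primrec.eq.comp (list_length.comp hσ) (fst.comp ha)).and
    ((primrecPred_forall_mem hσ ?_).and
    ((primrecPred_forall_mem (fst.comp (snd.comp ha)) ?_).and
    ((Primrec.eq.comp (list_length.comp hcs) (list_length.comp (snd.comp (snd.comp ha)))).and
    (primrecPred_forall_lt (list_length.comp (snd.comp (snd.comp ha))) ?_)))))
  · exact primrecPred_isTermCode (hF.comp fst) (hm.comp fst) snd
  · exact primrecPred_mem (primrec_substAtomCode
      (g := fun q : (Env × Instruction × List Judgment) × ℕ => hypSubst q.1.2.1.2.1)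
      (primrec_hypSubst.comp (hσ.comp (fst.comp fst)) snd) snd) (hs.comp fst)
  · exact primrecPred_mem ((nat_add.comp (hm.comp fst) (fst.comp hd)).pair
      ((primrec_childCodes (hm.comp fst) (hs.comp fst) (hσ.comp fst) hd).pair
        ((list_getD 0).comp (hcs.comp fst) snd))) (hst.comp fst)

variable (α) in
theorem primrec_step : Primrec fun p : Env × Instruction × List Judgment =>
    step α p.1 p.2.1 p.2.2 := by
  classical
  have hi : Primrec fun p : Env × Instruction × List Judgment => p.2.1 := fst.comp snd
  have hm : Primrec fun p : Env × Instruction × List Judgment => p.2.1.1.1 := fst.comp (fst.comp hi)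
  have hs : Primrec fun p : Env × Instruction × List Judgment => p.2.1.1.2.1 :=
    fst.comp (snd.comp (fst.comp hi))
  have hk : Primrec fun p : Env × Instruction × List Judgment => p.2.1.1.2.2 :=
    snd.comp (snd.comp (fst.comp hi))
  have hσ : Primrec fun p : Env × Instruction × List Judgment => p.2.1.2.1 := fst.comp (snd.comp hi)
  have hcs : Primrec fun p : Env × Instruction × List Judgment => p.2.1.2.2.1 :=
    fst.comp (snd.comp (snd.comp hi))
  refine list_append.comp (Primrec.ite (primrecPred_mem (snd.comp (snd.comp (snd.comp fst))) hs)
    (list_cons.comp (hm.pair (hs.pair (const _))) (const [])) (const []))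
    (list_append.comp (Primrec.ite (primrecPred_applies α)
    (list_cons.comp (hm.pair (hs.pair ?_)) (const [])) (const [])) (snd.comp snd))
  exact Primrec.encode.comp ((const 2).pair (hk.pair (hσ.pair hcs)))

variable (α) in
theorem primrec_run : Primrec₂ (run α) :=
  list_foldr (h := fun (x : Env × List Instruction) (p : Instruction × List Judgment) =>
    step α x.1 p.1 p.2) snd (const []) ((primrec_step α).comp
    ((fst.comp fst).pair ((fst.comp snd).pair (snd.comp snd))))

end Checker

end Primrec

/-! ### The search for a dynamical proof -/

section Search

/-- The table of the arities of the first `N` symbols. -/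
def arityTable (X : ℕ → Type*) [Encodable (Σ n, X n)] (N : ℕ) : List (Option ℕ) :=
  (List.range N).map fun e => (decode₂ (Σ n, X n) e).map Sigma.fst

theorem arityTable_getD (X : ℕ → Type*) [Encodable (Σ n, X n)] (N e : ℕ) :
    (arityTable X N).getD e none =
      if e < N then (decode₂ (Σ n, X n) e).map Sigma.fst else none := by
  split_ifs with h
  · simp [arityTable, h]
  · simp [arityTable, h]

theorem tables_arityTable (X : ℕ → Type*) [Encodable (Σ n, X n)] : Tables X (arityTable X) where
  sound N e n h := by
    rw [arityTable_getD] at h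
    split_ifs at h
    obtain ⟨⟨n, x⟩, hx, rfl⟩ := Option.map_eq_some_iff.1 h
    exact ⟨x, decode₂_eq_some.1 hx⟩
  complete n x := by
    filter_upwards [Filter.eventually_gt_atTop (encode (⟨n, x⟩ : Σ n, X n))] with N hN
    rw [arityTable_getD, if_pos hN, decode₂_encode]
    rfl

theorem computable_arityTable {X : ℕ → Type*} [Primcodable (Σ n, X n)]
    (h : Computable fun x : Σ n, X n => x.1) : Computable (arityTable X) := by
  have hstep : Computable fun e : ℕ => (decode₂ (Σ n, X n) e).map Sigma.fst :=
    Computable.option_map Primrec.decode₂.to_comp (h.comp .snd).to₂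
  refine (Computable.nat_rec (f := fun N : ℕ => N) (g := fun _ => ([] : List (Option ℕ)))
    (h := fun _ p => p.2 ++ [(decode₂ (Σ n, X n) p.1).map Sigma.fst]) Computable.id
    (Computable.const _) ?_).of_eq fun N => ?_
  · exact Computable.list_concat.comp (Computable.snd.comp .snd)
      (hstep.comp (Computable.fst.comp .snd))
  · induction N with
    | zero => rfl
    | succ N ih => simp only [arityTable, List.range_succ, List.map_append] at ih ⊢; rw [ih]; rfl

/-- The code of a fact, read as the code of an atomic formula in the generators of a covering. -/
def liftCode (c : ℕ) : ℕ := substAtomCode (fun v => [2 * (2 * v)]) c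

theorem primrec_liftCode : Primrec liftCode :=
  primrec_substAtomCode (g := fun _ v => [2 * (2 * v)]) (primrec_singleton
    (Primrec.nat_mul.comp (.const 2) (Primrec.nat_mul.comp (.const 2) .snd))) .id

/-- Of the two factors `2` in `liftCode`, the inner one is for the left summand and the outer one
for variables among symbols. -/
theorem liftCode_code {L : FirstOrder.Language.{u, v}} [Encodable (Σ n, L.Functions n)]
    [Encodable (Σ n, L.Relations n)] {α : Type w} [Encodable α] {γ : Type w'} [Encodable γ]
    (A : Atom L α) : liftCode A.code = (A.relabel (Sum.inl : α → α ⊕ γ)).code := by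
  rw [Atom.relabel_eq_subst]
  exact substAtomCode_code (fun x => by rw [word_var, encode_inl]) A

/-- The axioms, the relations and the goal of the classical proof with the code `x`. -/
def proofData (x : ℕ) : List ℕ × List ℕ × ℕ × ℕ := (decode x).getD ([], [], 0, 0)

/-- The candidate `k` for a set of instructions that yields a dynamical proof, with a bound for the
codes of the symbols and the code of the dynamical proof. -/
def candidate (k : ℕ) : ℕ × List Instruction × ℕ := (decode k).getD (0, [], 0)

/-- The environment in which a dynamical proof is searched. -/
def searchEnv (L : FirstOrder.Language.{u, v}) [Encodable (Σ n, L.Functions n)]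
    [Encodable (Σ n, L.Relations n)] (x N : ℕ) : Env :=
  (arityTable L.Functions N, arityTable L.Relations N, (proofData x).1,
    liftCode (proofData x).2.2.1)

open Classical in
/-- The code of the dynamical proof that the candidate `k` yields in the environment `e`, for the
classical proof with the code `x`. -/
noncomputable def candidateProof (α : Type w) [Encodable α] (e : Env) (x k : ℕ) : Option ℕ :=
  if ((0, (proofData x).2.1.map liftCode, (candidate k).2.2) : Judgment) ∈
      run α e (candidate k).2.1 then
    some (candidate k).2.2
  else none

theorem primrec_candidateProof {α : Type w} [Primcodable α] :
    Primrec fun q : Env × ℕ × ℕ => candidateProof α q.1 q.2.1 q.2.2 := by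
  have hx : Primrec proofData := Primrec.option_getD.comp Primrec.decode (.const _)
  have hk : Primrec candidate := Primrec.option_getD.comp Primrec.decode (.const _)
  have hx' : Primrec fun q : Env × ℕ × ℕ => (proofData q.2.1).2.1 :=
    Primrec.fst.comp (Primrec.snd.comp (hx.comp (Primrec.fst.comp .snd)))
  have hl : Primrec fun q : Env × ℕ × ℕ => (candidate q.2.2).2.1 :=
    Primrec.fst.comp (Primrec.snd.comp (hk.comp (Primrec.snd.comp .snd)))
  have hc : Primrec fun q : Env × ℕ × ℕ => (candidate q.2.2).2.2 :=
    Primrec.snd.comp (Primrec.snd.comp (hk.comp (Primrec.snd.comp .snd)))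
  have hs : Primrec fun q : Env × ℕ × ℕ => (proofData q.2.1).2.1.map liftCode :=
    Primrec.list_map hx' (primrec_liftCode.comp .snd).to₂
  exact Primrec.ite (primrecPred_mem ((Primrec.const 0).pair (hs.pair hc))
    ((primrec_run α).comp .fst hl)) (Primrec.option_some.comp hc) (.const none)

/-- The code of the dynamical proof that the candidate `k` yields, for the classical proof with the
code `x`. -/
noncomputable def searchStep (L : FirstOrder.Language.{u, v}) [Encodable (Σ n, L.Functions n)]
    [Encodable (Σ n, L.Relations n)] (α : Type w) [Encodable α] (x k : ℕ) : Option ℕ :=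
  candidateProof α (searchEnv L x (candidate k).1) x k

/-- Computability of the arities enters only in making the tables; the rest is primitive recursive.
-/
theorem computable_searchStep {L : FirstOrder.Language.{u, v}} {α : Type w} [Primcodable α]
    [Primcodable (Σ n, L.Functions n)] [Primcodable (Σ n, L.Relations n)]
    (hF : Computable fun f : (Σ n, L.Functions n) => f.1)
    (hP : Computable fun r : (Σ n, L.Relations n) => r.1) : Computable₂ (searchStep L α) := by
  have hx : Primrec proofData := Primrec.option_getD.comp Primrec.decode (.const _)
  have hk : Primrec candidate := Primrec.option_getD.comp Primrec.decode (.const _)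
  have hN : Computable fun p : ℕ × ℕ => (candidate p.2).1 :=
    (Primrec.fst.comp (hk.comp .snd)).to_comp
  have haxs : Primrec fun p : ℕ × ℕ => (proofData p.1).1 := Primrec.fst.comp (hx.comp .fst)
  have hgoal : Primrec fun p : ℕ × ℕ => liftCode (proofData p.1).2.2.1 :=
    primrec_liftCode.comp (Primrec.fst.comp (Primrec.snd.comp (Primrec.snd.comp (hx.comp .fst))))
  have henv : Computable fun p : ℕ × ℕ => searchEnv L p.1 (candidate p.2).1 :=
    ((computable_arityTable hF).comp hN).pair
      (((computable_arityTable hP).comp hN).pair (haxs.to_comp.pair hgoal.to_comp))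
  have h : Computable fun p : ℕ × ℕ => (searchEnv L p.1 (candidate p.2).1, p.1, p.2) :=
    henv.pair (Computable.fst.pair .snd)
  have h' := (primrec_candidateProof (α := α)).to_comp.comp h
  exact h'

variable {L : FirstOrder.Language.{u, v}} [Encodable (Σ n, L.Functions n)]
  [Encodable (Σ n, L.Relations n)] {α : Type w} [Encodable α] {D : DynTheory L}
  {R : Set (Atom L α)} {B : Atom L α}

theorem ClassicalProof.proofData_code (π : ClassicalProof D R B) :
    proofData π.code = (π.axs.map DynAxiom.code, π.rels.map Atom.code, B.code, π.deriv.code) := by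
  simp [proofData, ClassicalProof.code]

/-- Any accepted candidate will do, whether or not it is related to the derivation in `π`: the
environment consists of axioms of `D` and the goal `B`, and all judgments established in it are
true. -/
theorem ClassicalProof.exists_dynProof_of_searchStep (π : ClassicalProof D R B) {k c : ℕ}
    (h : c ∈ searchStep L α π.code k) : ∃ τ : DynProof D R B, τ.code = c := by
  unfold searchStep candidateProof at h
  split_ifs at h with hmem
  · obtain rfl : (candidate k).2.2 = c := by simpa using h
    have he : (searchEnv L π.code (candidate k).1).Sound D B := by
      refine ⟨(tables_arityTable _).sound _, (tables_arityTable _).sound _, fun x hx => ?_, ?_⟩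
      · simp only [searchEnv, π.proofData_code, List.mem_map] at hx
        obtain ⟨a, ha, rfl⟩ := hx
        exact ⟨a, π.axs_mem a ha, rfl⟩
      · simp only [searchEnv, π.proofData_code]
        exact liftCode_code B
    obtain ⟨τ, h1, h2⟩ := judgmentTrue_of_mem_run he _ hmem
      (Atom.relabel (Sum.inl : α → α ⊕ Fin 0) '' R) fun x hx => by
        simp only [π.proofData_code, List.map_map, List.mem_map, Function.comp_apply] at hx
        obtain ⟨A, hA, rfl⟩ := hx
        exact ⟨_, ⟨A, π.rels_mem A hA, rfl⟩, (liftCode_code A).symm⟩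
    exact ⟨⟨τ, h1⟩, h2⟩
  · simp at h

theorem ClassicalProof.exists_searchStep (hterm : Nonempty (L.Term α)) (π : ClassicalProof D R B) :
    ∃ k c, c ∈ searchStep L α π.code k := by
  -- The theory is cut down to the axioms listed in `π`, whose codes are all in the environment.
  have hprov := π.deriv.provable hterm (D := {a | a ∈ π.axs}) fun a ha => ha
  obtain ⟨l, c, hlc⟩ := hprov.exists_instructions (e := searchEnv L π.code)
    (s := (proofData π.code).2.1.map liftCode) (tables_arityTable _) (tables_arityTable _)
    (fun N a ha => by
      simp only [searchEnv, π.proofData_code]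
      exact List.mem_map_of_mem ha)
    (fun N => by
      simp only [searchEnv, π.proofData_code]
      exact liftCode_code B)
    (fun A hA => by
      obtain ⟨A, hA', rfl⟩ := List.mem_map.1 hA
      simp only [π.proofData_code, List.map_map, List.mem_map, Function.comp_apply]
      exact ⟨A, hA', liftCode_code A⟩)
  obtain ⟨N, hN⟩ := hlc.exists
  refine ⟨encode (N, l, c), c, ?_⟩
  simp only [searchStep, candidateProof, candidate, encodek, Option.getD_some]
  rw [if_pos hN]
  rfl

end Search

end Dynamical

theorem theorem1p3 (L : FirstOrder.Language.{u, v}) (α : Type w) (hterm : Nonempty (L.Term α)) :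
    (∀ (D : Dynamical.DynTheory L) (R : Set (Dynamical.Atom L α)) (B : Dynamical.Atom L α),
      Dynamical.ClassicalProof D R B → Nonempty (Dynamical.DynProof D R B)) ∧
    (∀ [Primcodable α] [Primcodable (Σ n, L.Functions n)] [Primcodable (Σ n, L.Relations n)],
      Computable (fun f : (Σ n, L.Functions n) => f.1) →
      Computable (fun r : (Σ n, L.Relations n) => r.1) →
      ∃ F : ℕ →. ℕ, Partrec F ∧
        ∀ (D : Dynamical.DynTheory L) (R : Set (Dynamical.Atom L α)) (B : Dynamical.Atom L α)
          (π : Dynamical.ClassicalProof D R B),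
          ∃ τ : Dynamical.DynProof D R B, τ.code ∈ F π.code) := by
  refine ⟨fun D R B π => π.nonempty_dynProof hterm, fun hF hP => ?_⟩
  -- The search takes the first accepted candidate. It depends only on the number `x`, and the
  -- derivation is needed only for termination.
  refine ⟨fun x => Nat.rfindOpt (Dynamical.searchStep L α x),
    Partrec.rfindOpt (Dynamical.computable_searchStep hF hP), fun D R B π => ?_⟩
  obtain ⟨c, hc⟩ := Part.dom_iff_mem.1 (Nat.rfindOpt_dom.2 (π.exists_searchStep hterm))
  obtain ⟨k, hk⟩ := Nat.rfindOpt_spec hc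
  obtain ⟨τ, rfl⟩ := π.exists_dynProof_of_searchStep hk
  exact ⟨τ, hc⟩
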